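/- Let $P$ be a Markov transition kernel on a Polish space $\mathcal X$ with invariant probability distribution $\pi$, and let $P$ be $\pi$-irreducible and Harris recurrent. Assume: (Small set) there are a Borel set $J$ with $\pi(J)>0$, a number $\beta>0$ and a probability measure $\nu$ with $P(x,\cdot)\ge\beta\,\mathbb 1(x\in J)\,\nu(\cdot)$ for all $x$. (Geometric drift) there are a measurable $V:\mathcal X\to[1,\infty)$ and constants $0\le\lambda<1$, $K<\infty$ such that $PV(x)\le\lambda V(x)$ for $x\notin J$ and $PV(x)\le K$ for $x\in J$. Let $(X_n,\Gamma_n)_{n\ge0}$ be the split chain on $\mathcal X\times\{0,1\}$: given $X_n=x$, $\Gamma_n=1$ with probability $\beta\,\mathbb 1(x\in J)$; given $(X_n,\Gamma_n)=(x,\gamma)$, $X_{n+1}\sim\nu$ if $\gamma=1$ and $X_{n+1}\sim Q(x,\cdot)=\dfrac{P(x,\cdot)-\beta\mathbb 1(x\in J)\nu(\cdot)}{1-\beta\mathbb 1(x\in J)}$ if $\gamma=0$. Let $T=T_1=\min\{n\ge1:\Gamma_{n-1}=1\}$, $T_{k+1}=\min\{n>T_k:\Gamma_{n-1}=1\}$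 and $R(n)=\min\{r\ge1:T_r>n\}$, and write $\mathbb P_\xi,\mathbb E_\xi$ when $X_0\sim\xi$. For Borel $f:\mathcal X\to\mathbb R$ put $\bar f=f-\pi(f)$, $\Xi(g)=\sum_{i=0}^{T-1}g(X_i)$ and $$\sigma^2_{\rm as}(P,f)=\frac{\mathbb E_\nu(\Xi(\bar f))^2}{\mathbb E_\nu T},\quad C_0(P)=\mathbb E_\pi T-\tfrac12,\quad C_1(P,f)=\sqrt{\mathbb E_\xi(\Xi(|\bar f|))^2},$$ $$C_2(P,f)=C_2(P,f,n)=\sqrt{\mathbb E_\xi\Big(\mathbb 1(T_1<n)\sum_{i=n}^{T_{R(n)}-1}|\bar f|(X_i)\Big)^2}.$$ Theorem. Suppose $\|\bar f\|_{V^{1/2}}:=\sup_x|\bar f(x)|/V^{1/2}(x)<\infty$. Then $\pi(V)$, $\pi(V^{1/2})$, $\pi(|f|)$ and $\mathbb E_\nu T$ are finite, and (i) $\displaystyle C_0(P)\le\frac{\lambda}{1-\lambda}\pi(V)+\frac{K-\lambda-\beta}{\beta(1-\lambda)}+\frac12$; (ii) $\displaystyle \sigma^2_{\rm as}(P,f)\le\|\bar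 f\|^2_{V^{1/2}}\left[\frac{1+\lambda^{1/2}}{1-\lambda^{1/2}}\pi(V)+\frac{2(K^{1/2}-\lambda^{1/2}-\beta)}{\beta(1-\lambda^{1/2})}\pi(V^{1/2})\right]$; (iii) for every initial distribution $\xi$, with $b:=\max(K^{1/2}-\lambda^{1/2}-\beta,\,0)$, $$C_1(P,f)^2\le\|\bar f\|^2_{V^{1/2}}\left[\frac{\xi(V)}{(1-\lambda^{1/2})^2}+\frac{2b}{\beta(1-\lambda^{1/2})^2}\,\xi(V^{1/2})+\frac{\beta(K-\lambda-\beta)+2b^2}{\beta^2(1-\lambda^{1/2})^2}\right]$$ whenever $\xi(V)<\infty$ (otherwise the right-hand side is infinite); (iv) for every $\xi$ and every $n$, $C_2(P,f,n)^2$ is bounded by the right-hand side of (iii) with $\xi$ replaced by $\xi P^n$ (when $\xi P^n(V)<\infty$). -/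

import Mathlib

open MeasureTheory ProbabilityTheory Filter
open scoped ENNReal

noncomputable section

/-! ### Homogeneous Markov chains -/

/-- The law on path space `ℕ → S` of the homogeneous Markov chain with transition kernel `κ` and
initial distribution `μ`. -/
def chainLaw {S : Type*} [MeasurableSpace S] (κ : Kernel S S) [IsMarkovKernel κ]
    (μ : Measure S) : Measure (ℕ → S) :=
  Kernel.trajMeasure (X := fun _ => S) μ
    (fun n => κ.comap (fun h : (i : Finset.Iic n) → S => h ⟨n, Finset.mem_Iic.2 le_rfl⟩)
      (measurable_pi_apply _))

/-- Harris recurrence (relative to the irreducibility measure `π`): from every starting point, every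
measurable set of positive `π`-measure is visited infinitely often almost surely. -/
def HarrisRecurrent {X : Type*} [MeasurableSpace X] (P : Kernel X X) [IsMarkovKernel P]
    (π : Measure X) : Prop :=
  ∀ A : Set X, MeasurableSet A → 0 < π A →
    ∀ x : X, ∀ᵐ ω ∂(chainLaw P (Measure.dirac x)), ∃ᶠ n in atTop, ω n ∈ A

/-! ### The small set condition and the split chain -/

/-- The one step small set condition `P(x, ·) ≥ β 1(x ∈ J) ν(·)`. -/
structure SmallSet {X : Type*} [MeasurableSpace X] (P : Kernel X X) (π : Measure X) where
  /-- the small set -/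
  J : Set X
  /-- the regeneration rate -/
  β : ℝ
  /-- the regeneration measure -/
  ν : Measure X
  measurableSet_J : MeasurableSet J
  measure_J_pos : 0 < π J
  β_pos : 0 < β
  isProbabilityMeasure_ν : IsProbabilityMeasure ν
  minorization : ∀ x ∈ J, ∀ A : Set X, MeasurableSet A → ENNReal.ofReal β * ν A ≤ P x A

namespace SmallSet

section

variable {X : Type*} [MeasurableSpace X] {P : Kernel X X} {π : Measure X} (S : SmallSet P π)

instance : IsProbabilityMeasure S.ν := S.isProbabilityMeasure_ν

lemma smul_le {x : X} (hx : x ∈ S.J) : ENNReal.ofReal S.β • S.ν ≤ P x :=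
  Measure.le_iff.2 fun A hA => by simpa using S.minorization x hx A hA

instance : IsFiniteMeasure (ENNReal.ofReal S.β • S.ν) :=
  Measure.smul_finite _ ENNReal.ofReal_ne_top

lemma nonempty_J : S.J.Nonempty := nonempty_of_measure_ne_zero S.measure_J_pos.ne'

lemma β_le_one [IsMarkovKernel P] : S.β ≤ 1 := by
  obtain ⟨x, hx⟩ := S.nonempty_J
  simpa using S.minorization x hx Set.univ MeasurableSet.univ

/-- The residual kernel `Q(x, ·) = (P(x, ·) - β 1(x ∈ J) ν) / (1 - β 1(x ∈ J))`. When `β = 1` this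
is `0 / 0` on `J`; there we set `Q(x, ·) = ν`, a value which is used with probability zero. -/
def residual : Kernel X X where
  toFun := by
    classical
    exact fun x => if x ∈ S.J then
      (if S.β < 1 then (ENNReal.ofReal (1 - S.β))⁻¹ • (P x - ENNReal.ofReal S.β • S.ν) else S.ν)
      else P x
  measurable' := by
    classical
    refine Measure.measurable_of_measurable_coe _ fun A hA => ?_
    have h : (fun x => (if x ∈ S.J then
        (if S.β < 1 then (ENNReal.ofReal (1 - S.β))⁻¹ • (P x - ENNReal.ofReal S.β • S.ν)
          else S.ν) else P x) A) =
        fun x => if x ∈ S.J then (if S.β < 1 then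
          (ENNReal.ofReal (1 - S.β))⁻¹ * (P x A - ENNReal.ofReal S.β * S.ν A)
          else S.ν A) else P x A := by
      funext x
      by_cases hx : x ∈ S.J
      · by_cases hβ : S.β < 1
        · simp [hx, hβ, Measure.sub_apply hA (S.smul_le hx)]
        · simp [hx, hβ]
      · simp [hx]
    rw [h]
    have hP : Measurable fun x => P x A := P.measurable_coe hA
    refine Measurable.ite S.measurableSet_J ?_ hP
    by_cases hβ : S.β < 1
    · simp only [hβ, if_true]
      exact (hP.sub_const _).const_mul _
    · simp [hβ]

instance [IsMarkovKernel P] : IsMarkovKernel S.residual := by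
  classical
  refine ⟨fun x => ⟨?_⟩⟩
  change (if x ∈ S.J then (if S.β < 1 then
    (ENNReal.ofReal (1 - S.β))⁻¹ • (P x - ENNReal.ofReal S.β • S.ν) else S.ν)
    else P x) Set.univ = 1
  by_cases hx : x ∈ S.J
  · by_cases hβ : S.β < 1
    · have h1 : ENNReal.ofReal (1 - S.β) = 1 - ENNReal.ofReal S.β := by
        rw [ENNReal.ofReal_sub _ S.β_pos.le, ENNReal.ofReal_one]
      have h2 : ENNReal.ofReal (1 - S.β) ≠ 0 := by simpa using hβ
      simp [hx, hβ, Measure.sub_apply MeasurableSet.univ (S.smul_le hx), ← h1]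
      exact ENNReal.inv_mul_cancel h2 ENNReal.ofReal_ne_top
    · simp [hx, hβ]
  · simp [hx]

/-- The law of a bell given the current position:
`Pr(Γ = 1 | X = x) = β 1(x ∈ J)`. -/
def bell : Kernel X Bool :=
  haveI : DecidablePred (· ∈ S.J) := Classical.decPred _
  Kernel.piecewise S.measurableSet_J
    (Kernel.const X (ENNReal.ofReal S.β • Measure.dirac true
      + ENNReal.ofReal (1 - S.β) • Measure.dirac false))
    (Kernel.const X (Measure.dirac false))

instance [IsMarkovKernel P] : IsMarkovKernel S.bell := by
  classical
  refine ⟨fun x => ⟨?_⟩⟩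
  by_cases hx : x ∈ S.J
  · simp [bell, Kernel.piecewise_apply, hx, ← ENNReal.ofReal_add S.β_pos.le
      (sub_nonneg.2 S.β_le_one)]
  · simp [bell, Kernel.piecewise_apply, hx]

/-- The law of the next position given the current position and bell: `ν` if the bell rings, and
the residual kernel otherwise. -/
def move : Kernel (X × Bool) X :=
  haveI : DecidablePred (· ∈ (Prod.snd ⁻¹' {true} : Set (X × Bool))) := Classical.decPred _
  Kernel.piecewise (measurable_snd (measurableSet_singleton true))
    (Kernel.const (X × Bool) S.ν) (S.residual.comap Prod.fst measurable_fst)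

instance [IsMarkovKernel P] : IsMarkovKernel S.move := by
  unfold move; infer_instance

/-- One step of the split chain: move, then draw the bell of the new position. -/
def splitKernel : Kernel (X × Bool) (X × Bool) :=
  S.move ⊗ₖ Kernel.prodMkLeft (X × Bool) S.bell

instance [IsMarkovKernel P] : IsMarkovKernel S.splitKernel := by
  unfold splitKernel; infer_instance

/-- The law `Pr_ξ` of the split chain `(X_n, Γ_n)_n` with `X_0 ∼ ξ`. -/
def law [IsMarkovKernel P] (ξ : Measure X) : Measure (ℕ → X × Bool) :=
  chainLaw S.splitKernel (ξ ⊗ₘ S.bell)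

end

end SmallSet

/-! ### Regeneration times and block sums, as functionals of the path `ω n = (X_n, Γ_n)` -/

/-- The regeneration epochs: `T_{k+1} = min {n > T_k : Γ_{n-1} = 1}` (`⊤` if there is no such `n`),
with `T_0 = 0`. -/
def regenTime {X : Type*} (ω : ℕ → X × Bool) : ℕ → ℕ∞
  | 0 => 0
  | k + 1 => sInf {m : ℕ∞ | ∃ n : ℕ, m = n ∧ regenTime ω k < n ∧ (ω (n - 1)).2 = true}

/-- `R(n) = min {r ≥ 1 : T_r > n}`. -/
def regenIndex {X : Type*} (ω : ℕ → X × Bool) (n : ℕ) : ℕ :=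
  sInf {r : ℕ | 1 ≤ r ∧ (n : ℕ∞) < regenTime ω r}

/-- The first block sum `Ξ(g) = ∑_{i=0}^{T-1} g(X_i)` of a real function `g`
(meaningful when `T < ∞`). -/
def blockSum {X : Type*} (g : X → ℝ) (ω : ℕ → X × Bool) : ℝ :=
  ∑ i ∈ Finset.range (regenTime ω 1).toNat, g (ω i).1

/-- The sum `∑_{i=m}^{t-1} |g|(X_i)`, valued in `[0, ∞]`, where `t ≤ ∞`. -/
def absSum {X : Type*} (g : X → ℝ) (ω : ℕ → X × Bool) (m : ℕ) (t : ℕ∞) : ℝ≥0∞ :=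
  haveI : DecidablePred fun i : ℕ => m ≤ i ∧ (i : ℕ∞) < t := Classical.decPred _
  ∑' i : ℕ, if m ≤ i ∧ (i : ℕ∞) < t then ENNReal.ofReal |g (ω i).1| else 0

namespace SmallSet

section

variable {X : Type*} [MeasurableSpace X] {P : Kernel X X} [IsMarkovKernel P] {π : Measure X}
  (S : SmallSet P π)

/-- `E_ξ T`. -/
def meanT (ξ : Measure X) : ℝ≥0∞ := ∫⁻ ω, (regenTime ω 1 : ℝ≥0∞) ∂(S.law ξ)

/-- `C₀(P) = E_π T - 1/2`, as an extended real number. -/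
def C₀ : EReal := (S.meanT π : EReal) - ((1 / 2 : ℝ) : EReal)

/-- The centred function `f - π(f)`. -/
def centred (_S : SmallSet P π) (f : X → ℝ) (x : X) : ℝ := f x - ∫ y, f y ∂π

/-- The asymptotic variance `σ²_as(P, f) = E_ν (Ξ(f - π(f)))² / E_ν T`. -/
def asVar (f : X → ℝ) : ℝ≥0∞ :=
  (∫⁻ ω, ENNReal.ofReal (blockSum (S.centred f) ω ^ 2) ∂(S.law S.ν)) / S.meanT S.ν

/-- `C₁(P, f) = √(E_ξ (Ξ(|f - π(f)|))²)`. -/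
def C₁ (f : X → ℝ) (ξ : Measure X) : ℝ≥0∞ :=
  (∫⁻ ω, absSum (S.centred f) ω 0 (regenTime ω 1) ^ 2 ∂(S.law ξ)) ^ (1 / 2 : ℝ)

/-- `C₂(P, f, n) = √(E_ξ (1(T_1 < n) ∑_{i=n}^{T_{R(n)}-1} |f - π(f)|(X_i))²)`. -/
def C₂ (f : X → ℝ) (ξ : Measure X) (n : ℕ) : ℝ≥0∞ :=
  (∫⁻ ω, ({ω : ℕ → X × Bool | regenTime ω 1 < (n : ℕ∞)}.indicator
    (fun ω => absSum (S.centred f) ω n (regenTime ω (regenIndex ω n))) ω) ^ 2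
      ∂(S.law ξ)) ^ (1 / 2 : ℝ)

end

end SmallSet

/-- The quotient `|g(x)| / V(x)^{1/2}`. -/
def weightedAbs {X : Type*} (V g : X → ℝ) (x : X) : ℝ := |g x| / √(V x)

/-- The weighted norm `‖g‖_{V^{1/2}} = sup_x |g(x)| / V(x)^{1/2}`, for `g` such that this supremum
is finite. -/
def weightedNorm {X : Type*} (V g : X → ℝ) : ℝ := ⨆ x, weightedAbs V g x

/-- The right-hand side of the bounds for `C₁²` and `C₂²` (without the factor `‖·‖²`), as a function
of the initial distribution `η`. -/
def initialBound {X : Type*} [MeasurableSpace X] (lam K β : ℝ) (V : X → ℝ) (η : Measure X) : ℝ :=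
  1 / (1 - √lam) ^ 2 * ∫ x, V x ∂η
    + 2 * max (√K - √lam - β) 0 / (β * (1 - √lam) ^ 2) * ∫ x, √(V x) ∂η
    + (β * (K - lam - β) + 2 * max (√K - √lam - β) 0 ^ 2) / (β ^ 2 * (1 - √lam) ^ 2)

end

/-! Write `T` for the first regeneration time and let `tabooOp`, here K, be one step of the chain
killed when the bell rings: P(x, ·) = K(x, ·) + β 1(x ∈ J) ν. The Green operator G = ∑ Kⁿ gives E_x
Ξ(u) = G u(x), and G u is the least nonnegative solution of w = u + K w. Everything reduces to
estimates of G.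

Drift: for a suitable b, the affine function w = U/(1-l) + b satisfies U + K w ≤ w whenever U has
drift constants l, k, so G U ≤ w (`tabooOp_green_le_of_drift`). By Jensen √V drifts with constants
√λ and √K, so this applies both to V and to √V.

Second moments: expanding the square of a block sum and conditioning on the earlier index gives E_x
Ξ(u)² ≤ G(u² + 2u·K G u)(x) (`expect_blockPartialSum_sq_le`). For u ≤ N√V the drift estimate for √V
bounds the inner function by N² times a combination of V and √V (`secondMoment_le`). A further
application of G, using the estimates for V and √V, gives (iii). Integrating against π instead gives
(ii), because Kac's formula βπ(J) ∫ G u dν = ∫ u dπ with u = 1 identifies βπ(J) as 1/E_ν T.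

For (i), E_π T = ∫ G 1 dπ and G 1 = 1 + K G 1 ≤ 1 + K G V. For (iv), the sum from time n to the end
of the current block is at most the first block sum of the path shifted by n, and that shifted path
is the split chain started from ξPⁿ. -/

noncomputable section

/-! ### The Markov property on path space -/

section MarkovProperty

variable {S : Type*} [MeasurableSpace S]

/-- Two laws on path space with the same initial marginal and the same one step transition
mechanism agree. -/
lemma pathLaw_ext (κ : Kernel S S) {ρ ρ' : Measure (ℕ → S)}
    [IsProbabilityMeasure ρ] [IsProbabilityMeasure ρ']
    (h0 : ∀ h : S → ℝ≥0∞, Measurable h → ∫⁻ ω, h (ω 0) ∂ρ = ∫⁻ ω, h (ω 0) ∂ρ')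
    (hρ : ∀ (n : ℕ) (F : ℕ → S → ℝ≥0∞), (∀ i, Measurable (F i)) →
      ∀ h : S → ℝ≥0∞, Measurable h →
      ∫⁻ ω, (∏ i ∈ Finset.range (n + 1), F i (ω i)) * h (ω (n + 1)) ∂ρ
        = ∫⁻ ω, (∏ i ∈ Finset.range (n + 1), F i (ω i)) * ∫⁻ y, h y ∂(κ (ω n)) ∂ρ)
    (hρ' : ∀ (n : ℕ) (F : ℕ → S → ℝ≥0∞), (∀ i, Measurable (F i)) →
      ∀ h : S → ℝ≥0∞, Measurable h →
      ∫⁻ ω, (∏ i ∈ Finset.range (n + 1), F i (ω i)) * h (ω (n + 1)) ∂ρ'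
        = ∫⁻ ω, (∏ i ∈ Finset.range (n + 1), F i (ω i)) * ∫⁻ y, h y ∂(κ (ω n)) ∂ρ') :
    ρ = ρ' := by
  have main : ∀ (n : ℕ) (F : ℕ → S → ℝ≥0∞), (∀ i, Measurable (F i)) →
      ∫⁻ ω, ∏ i ∈ Finset.range (n + 1), F i (ω i) ∂ρ
        = ∫⁻ ω, ∏ i ∈ Finset.range (n + 1), F i (ω i) ∂ρ' := by
    intro n
    induction n with
    | zero => intro F hF; simpa using h0 (F 0) (hF 0)
    | succ n ih =>
      intro F hF
      -- The last coordinate is integrated out through `κ` and the result absorbed into the factor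
      -- at time `n`, which leaves a shorter product.
      set F' : ℕ → S → ℝ≥0∞ := fun i z =>
        if i = n then F n z * ∫⁻ y, F (n + 1) y ∂(κ z) else F i z with hF'
      have hF'm : ∀ i, Measurable (F' i) := by
        intro i
        by_cases hi : i = n
        · simp only [hF', hi, if_true]
          exact (hF n).mul (hF (n + 1)).lintegral_kernel
        · simpa only [hF', hi, if_false] using hF i
      have e : ∀ ω : ℕ → S, (∏ i ∈ Finset.range (n + 1), F i (ω i)) *
          ∫⁻ y, F (n + 1) y ∂(κ (ω n)) = ∏ i ∈ Finset.range (n + 1), F' i (ω i) := by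
        intro ω
        rw [Finset.prod_range_succ, Finset.prod_range_succ, mul_assoc]
        congr 1
        · refine Finset.prod_congr rfl fun i hi => ?_
          simp [hF', (Finset.mem_range.1 hi).ne]
        · simp [hF']
      calc _ = ∫⁻ ω, (∏ i ∈ Finset.range (n + 1), F i (ω i)) * F (n + 1) (ω (n + 1)) ∂ρ :=
            lintegral_congr fun ω => Finset.prod_range_succ _ _
        _ = ∫⁻ ω, ∏ i ∈ Finset.range (n + 1), F' i (ω i) ∂ρ := by
            rw [hρ n F hF _ (hF _)]; exact lintegral_congr e
        _ = ∫⁻ ω, ∏ i ∈ Finset.range (n + 1), F' i (ω i) ∂ρ' := ih F' hF'm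
        _ = ∫⁻ ω, (∏ i ∈ Finset.range (n + 1), F i (ω i)) * F (n + 1) (ω (n + 1)) ∂ρ' := by
            rw [hρ' n F hF _ (hF _)]; exact (lintegral_congr e).symm
        _ = _ := (lintegral_congr fun ω => Finset.prod_range_succ _ _).symm
  refine ext_of_generate_finite _ (generateFrom_squareCylinders (α := fun _ : ℕ => S)).symm
    (isPiSystem_squareCylinders (fun _ => MeasurableSpace.isPiSystem_measurableSet) (by simp)) ?_
    (by simp)
  rintro _ ⟨s, t, ht, rfl⟩
  have ht' : ∀ i, MeasurableSet (t i) := fun i => ht i (Set.mem_univ i)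
  set N := s.sup id
  set F : ℕ → S → ℝ≥0∞ := fun i => if i ∈ s then (t i).indicator 1 else 1 with hFdef
  have hF : ∀ i, Measurable (F i) := by
    intro i
    by_cases hi : i ∈ s
    · simp only [hFdef, hi, if_true]; exact measurable_one.indicator (ht' i)
    · simp only [hFdef, hi, if_false]; exact measurable_one
  have hms : MeasurableSet ((s : Set ℕ).pi t) :=
    MeasurableSet.pi s.countable_toSet fun i _ => ht' i
  have e : ∀ ω : ℕ → S, ((s : Set ℕ).pi t).indicator 1 ω
      = ∏ i ∈ Finset.range (N + 1), F i (ω i) := by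
    intro ω
    by_cases hω : ω ∈ (s : Set ℕ).pi t
    · rw [Set.indicator_of_mem hω, Finset.prod_eq_one]
      · rfl
      · intro i _
        by_cases hi : i ∈ s
        · simp [hFdef, hi, hω i hi]
        · simp [hFdef, hi]
    · rw [Set.indicator_of_notMem hω]
      simp only [Set.mem_pi, not_forall] at hω
      obtain ⟨i, hi, hit⟩ := hω
      refine (Finset.prod_eq_zero (i := i) ?_ ?_).symm
      · exact Finset.mem_range.2 (Nat.lt_succ_of_le (Finset.le_sup (f := id) hi))
      · have hi' : i ∈ s := hi
        simp [hFdef, hi', hit]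
  rw [← lintegral_indicator_one hms, ← lintegral_indicator_one hms, lintegral_congr e,
    lintegral_congr e, main N F hF]

variable (κ : Kernel S S) [IsMarkovKernel κ]

/-- The law of the chain as a kernel in the starting point. -/
def chainKernel : Kernel S (ℕ → S) :=
  (Kernel.traj (X := fun _ => S)
    (fun n => κ.comap (fun h : (i : Finset.Iic n) → S => h ⟨n, Finset.mem_Iic.2 le_rfl⟩)
      (measurable_pi_apply _)) 0).comap
    (MeasurableEquiv.piUnique (fun _ : Finset.Iic 0 => S)).symm (MeasurableEquiv.measurable _)

instance : IsMarkovKernel (chainKernel κ) := by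
  unfold chainKernel; infer_instance

lemma chainLaw_eq_bind (μ : Measure S) : chainLaw κ μ = μ.bind (chainKernel κ) := by
  ext s hs
  rw [chainLaw, Kernel.trajMeasure, Measure.bind_apply hs (Kernel.aemeasurable _),
    Measure.bind_apply hs (Kernel.aemeasurable _),
    lintegral_map (Kernel.measurable_coe _ hs) (MeasurableEquiv.measurable _)]
  rfl

instance (μ : Measure S) [IsProbabilityMeasure μ] : IsProbabilityMeasure (chainLaw κ μ) := by
  rw [chainLaw_eq_bind]; infer_instance

/-- Integrates a product of a function of the history and a function of the next state against the
disintegration of the trajectory measure along its history. -/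
lemma lintegral_chainLaw_step (μ : Measure S) [IsProbabilityMeasure μ] (n : ℕ)
    {F : ℕ → S → ℝ≥0∞} (hF : ∀ i, Measurable (F i)) {h : S → ℝ≥0∞} (hh : Measurable h) :
    ∫⁻ ω, (∏ i ∈ Finset.range (n + 1), F i (ω i)) * h (ω (n + 1)) ∂(chainLaw κ μ)
      = ∫⁻ ω, (∏ i ∈ Finset.range (n + 1), F i (ω i)) * ∫⁻ y, h y ∂(κ (ω n)) ∂(chainLaw κ μ) := by
  have key := Kernel.map_frestrictLe_trajMeasure_compProd_eq_map_trajMeasure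
    (X := fun _ => S) (μ₀ := μ) (a := n)
    (κ := fun n => κ.comap (fun h : (i : Finset.Iic n) → S => h ⟨n, Finset.mem_Iic.2 le_rfl⟩)
      (measurable_pi_apply _))
  have hprod : Measurable fun y : (Finset.Iic n) → S =>
      ∏ i : Finset.Iic n, F i (y i) :=
    Finset.measurable_prod _ fun i _ => (hF i).comp (measurable_pi_apply i)
  have hG : Measurable fun p : ((Finset.Iic n) → S) × S =>
      (∏ i : Finset.Iic n, F i (p.1 i)) * h p.2 :=
    (hprod.comp measurable_fst).mul (hh.comp measurable_snd)
  have e : ∀ ω : ℕ → S, ∏ i : Finset.Iic n, F i (Preorder.frestrictLe (π := fun _ => S) n ω i)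
      = ∏ i ∈ Finset.range (n + 1), F i (ω i) := by
    intro ω
    refine (Finset.prod_coe_sort (Finset.Iic n) (fun i => F i (ω i))).trans ?_
    congr 1
    ext i; simp
  have := congrArg (fun ρ : Measure (((Finset.Iic n) → S) × S) =>
    ∫⁻ p, (∏ i : Finset.Iic n, F i (p.1 i)) * h p.2 ∂ρ) key
  beta_reduce at this
  rw [lintegral_map hG (by fun_prop), Measure.lintegral_compProd hG,
    lintegral_map (Measurable.lintegral_kernel_prod_right (κ := _) hG) (by fun_prop)] at this
  simp only [e] at this
  rw [chainLaw, ← this]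
  refine lintegral_congr fun ω => ?_
  rw [lintegral_const_mul _ hh]
  rfl

lemma lintegral_chainLaw_zero (μ : Measure S) {h : S → ℝ≥0∞} (hh : Measurable h) :
    ∫⁻ ω, h (ω 0) ∂(chainLaw κ μ) = ∫⁻ z, h z ∂μ := by
  have hh' : Measurable fun ω : ℕ → S => h (ω 0) := by fun_prop
  rw [chainLaw_eq_bind, Measure.lintegral_bind (Kernel.aemeasurable _) hh'.aemeasurable]
  refine lintegral_congr fun z => ?_
  have h1 := Kernel.traj_map_frestrictLe_apply (X := fun _ => S)
    (κ := fun n => κ.comap (fun h : (i : Finset.Iic n) → S => h ⟨n, Finset.mem_Iic.2 le_rfl⟩)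
      (measurable_pi_apply _)) 0 0
      ((MeasurableEquiv.piUnique (fun _ : Finset.Iic 0 => S)).symm z)
  rw [Kernel.partialTraj_self, Kernel.id_apply] at h1
  have h2 : Measurable fun y : Finset.Iic 0 → S => h (y ⟨0, by simp⟩) := by fun_prop
  have h3 := congrArg (fun ρ : Measure (Finset.Iic 0 → S) => ∫⁻ y, h (y ⟨0, by simp⟩) ∂ρ) h1
  beta_reduce at h3
  rw [lintegral_map h2 (by fun_prop), lintegral_dirac' _ h2] at h3
  exact h3

/-- The path `z, ω 0, ω 1, …`. -/
def pathCons (p : S × (ℕ → S)) : ℕ → S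
  | 0 => p.1
  | n + 1 => p.2 n

lemma measurable_pathCons : Measurable (pathCons (S := S)) := by
  refine measurable_pi_lambda _ fun n => ?_
  cases n with
  | zero => exact measurable_fst
  | succ n => exact (measurable_pi_apply n).comp measurable_snd

lemma comp_apply_eq_chainLaw (z : S) : (chainKernel κ ∘ₖ κ) z = chainLaw κ (κ z) := by
  rw [Kernel.comp_apply, chainLaw_eq_bind]

/-- Drawing the start from `μ` and then appending a fresh chain started from `κ z` yields the same
initial marginal and the same one step transitions, so `pathLaw_ext` identifies the two laws. -/
lemma chainLaw_eq_map_pathCons (μ : Measure S) [IsProbabilityMeasure μ] :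
    chainLaw κ μ = (μ ⊗ₘ (chainKernel κ ∘ₖ κ)).map pathCons := by
  have : IsProbabilityMeasure ((μ ⊗ₘ (chainKernel κ ∘ₖ κ)).map pathCons) :=
    Measure.isProbabilityMeasure_map measurable_pathCons.aemeasurable
  have hcons : ∀ F : (ℕ → S) → ℝ≥0∞, Measurable F →
      ∫⁻ ω, F ω ∂((μ ⊗ₘ (chainKernel κ ∘ₖ κ)).map pathCons)
        = ∫⁻ z, ∫⁻ ω, F (pathCons (z, ω)) ∂(chainLaw κ (κ z)) ∂μ := by
    intro F hF
    have hm : Measurable fun p : S × (ℕ → S) => F (pathCons p) := hF.comp measurable_pathCons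
    rw [lintegral_map hF measurable_pathCons, Measure.lintegral_compProd hm]
    simp only [comp_apply_eq_chainLaw]
  refine pathLaw_ext κ ?_ (fun n F hF h hh => lintegral_chainLaw_step κ μ n hF hh) ?_
  · intro h hh
    rw [lintegral_chainLaw_zero κ μ hh, hcons _ (by fun_prop)]
    simp [pathCons]
  · intro n F hF h hh
    have hκ : Measurable fun z => ∫⁻ y, h y ∂(κ z) := hh.lintegral_kernel
    have hP : Measurable fun ω : ℕ → S => ∏ i ∈ Finset.range (n + 1), F i (ω i) :=
      Finset.measurable_prod _ fun i _ => (hF i).comp (measurable_pi_apply i)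
    rw [hcons (fun ω => (∏ i ∈ Finset.range (n + 1), F i (ω i)) * h (ω (n + 1))) (by fun_prop),
      hcons (fun ω => (∏ i ∈ Finset.range (n + 1), F i (ω i)) * ∫⁻ y, h y ∂(κ (ω n)))
        (hP.mul (hκ.comp (measurable_pi_apply n)))]
    refine lintegral_congr fun z => ?_
    simp only [Finset.prod_range_succ' _ n, pathCons]
    -- The first transition of the extended path is the initial draw of the appended chain; every
    -- later transition is a transition of that chain, with time moved back by one.
    cases n with
    | zero =>
      simp only [Finset.range_zero, Finset.prod_empty, one_mul]
      rw [lintegral_const_mul (F 0 z) (f := fun ω : ℕ → S => h (ω 0)) (by fun_prop),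
        lintegral_chainLaw_zero κ _ hh]
      simp
    | succ n =>
      have := lintegral_chainLaw_step κ (κ z) n (fun i => hF (i + 1)) hh
      have hP' : Measurable fun ω : ℕ → S => ∏ i ∈ Finset.range (n + 1), F (i + 1) (ω i) :=
        Finset.measurable_prod _ fun i _ => (hF (i + 1)).comp (measurable_pi_apply i)
      simp only [mul_right_comm _ (F 0 z)]
      rw [lintegral_mul_const (F 0 z) (f := fun ω : ℕ → S =>
          (∏ i ∈ Finset.range (n + 1), F (i + 1) (ω i)) * h (ω (n + 1))) (by fun_prop),
        lintegral_mul_const (F 0 z) (f := fun ω : ℕ → S =>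
          (∏ i ∈ Finset.range (n + 1), F (i + 1) (ω i)) * ∫⁻ y, h y ∂(κ (ω n)))
          (hP'.mul (hκ.comp (measurable_pi_apply n))), this]

/-- First step decomposition of the law of a Markov chain. -/
lemma lintegral_chainLaw_first_step (μ : Measure S) [IsProbabilityMeasure μ]
    {F : S × (ℕ → S) → ℝ≥0∞} (hF : Measurable F) :
    ∫⁻ ω, F (ω 0, fun n => ω (n + 1)) ∂(chainLaw κ μ)
      = ∫⁻ z, ∫⁻ ω, F (z, ω) ∂(chainLaw κ (κ z)) ∂μ := by
  have hm : Measurable fun ω : ℕ → S => F (ω 0, fun n => ω (n + 1)) := by fun_prop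
  have hm' : Measurable fun p : S × (ℕ → S) =>
      F (pathCons p 0, fun n => pathCons p (n + 1)) := hm.comp measurable_pathCons
  rw [chainLaw_eq_map_pathCons, lintegral_map hm measurable_pathCons,
    Measure.lintegral_compProd hm']
  simp only [comp_apply_eq_chainLaw]
  rfl

end MarkovProperty

lemma isMarkovKernel_pow {X : Type*} [MeasurableSpace X] (P : Kernel X X) [IsMarkovKernel P]
    (n : ℕ) : IsMarkovKernel (P ^ n : Kernel X X) := by
  induction n with
  | zero => rw [pow_zero]; exact inferInstanceAs (IsMarkovKernel Kernel.id)
  | succ n ih =>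
    rw [pow_succ']; exact inferInstanceAs (IsMarkovKernel (P ∘ₖ (P ^ n : Kernel X X)))

namespace SmallSet

/-! ### The killed (taboo) kernel and its Green operator -/

section Taboo

variable {X : Type*} [MeasurableSpace X] {P : Kernel X X} {π : Measure X} (S : SmallSet P π)

lemma bell_true (x : X) [Decidable (x ∈ S.J)] :
    S.bell x {true} = if x ∈ S.J then ENNReal.ofReal S.β else 0 := by
  classical
  by_cases hx : x ∈ S.J <;> simp [bell, Kernel.piecewise_apply, hx]

lemma bell_false (x : X) [Decidable (x ∈ S.J)] :
    S.bell x {false} = if x ∈ S.J then ENNReal.ofReal (1 - S.β) else 1 := by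
  classical
  by_cases hx : x ∈ S.J <;> simp [bell, Kernel.piecewise_apply, hx]

lemma lintegral_bell (x : X) (h : Bool → ℝ≥0∞) :
    ∫⁻ γ, h γ ∂(S.bell x) = S.bell x {true} * h true + S.bell x {false} * h false := by
  rw [lintegral_fintype]
  simp [mul_comm]

lemma bell_true_add_false [IsMarkovKernel P] (x : X) :
    S.bell x {true} + S.bell x {false} = 1 := by
  simpa only [lintegral_one, measure_univ, mul_one] using (S.lintegral_bell x fun _ => 1).symm

/-- The law of the next position on the event that the bell does not ring. -/
def taboo (x : X) : Measure X := S.bell x {false} • S.residual x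

lemma taboo_of_notMem {x : X} (hx : x ∉ S.J) : S.taboo x = P x := by
  classical
  rw [taboo, bell_false, if_neg hx, one_smul]
  exact if_neg hx

lemma taboo_add_smul [IsMarkovKernel P] {x : X} (hx : x ∈ S.J) :
    S.taboo x + ENNReal.ofReal S.β • S.ν = P x := by
  classical
  have hle := S.smul_le hx
  rw [taboo, bell_false, if_pos hx]
  have hr : S.residual x = if S.β < 1 then
      (ENNReal.ofReal (1 - S.β))⁻¹ • (P x - ENNReal.ofReal S.β • S.ν) else S.ν := if_pos hx
  by_cases hβ : S.β < 1
  · rw [hr, if_pos hβ, smul_smul, ENNReal.mul_inv_cancel (by simpa using hβ)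
      ENNReal.ofReal_ne_top, one_smul, Measure.sub_add_cancel_of_le hle]
  -- When β = 1, the residual value has weight zero, and P(x, ·) ≥ ν with equal total masses forces
  -- P(x, ·) = ν.
  · have h1 : S.β = 1 := le_antisymm S.β_le_one (not_lt.1 hβ)
    rw [h1] at hle ⊢
    simp only [sub_self, ENNReal.ofReal_zero, zero_smul, zero_add, ENNReal.ofReal_one,
      one_smul] at hle ⊢
    exact Measure.eq_of_le_of_measure_univ_eq hle (by simp)

lemma taboo_add_bell_smul [IsMarkovKernel P] (x : X) :
    S.taboo x + S.bell x {true} • S.ν = P x := by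
  classical
  by_cases hx : x ∈ S.J
  · rw [bell_true, if_pos hx, S.taboo_add_smul hx]
  · rw [bell_true, if_neg hx, S.taboo_of_notMem hx, zero_smul, add_zero]

lemma taboo_le [IsMarkovKernel P] (x : X) : S.taboo x ≤ P x := by
  conv_rhs => rw [← S.taboo_add_bell_smul x]
  exact Measure.le_add_right le_rfl

instance [IsMarkovKernel P] (x : X) : IsFiniteMeasure (S.taboo x) :=
  isFiniteMeasure_of_le _ (S.taboo_le x)

/-- The operator `u ↦ (x ↦ E_x [u(X_1); Γ_0 = 0])`. -/
def tabooOp (u : X → ℝ≥0∞) (x : X) : ℝ≥0∞ := ∫⁻ y, u y ∂(S.taboo x)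

lemma tabooOp_eq (u : X → ℝ≥0∞) (x : X) :
    S.tabooOp u x = S.bell x {false} * ∫⁻ y, u y ∂(S.residual x) := by
  rw [tabooOp, taboo, lintegral_smul_measure, smul_eq_mul]

lemma tabooOp_mono {u v : X → ℝ≥0∞} (h : ∀ x, u x ≤ v x) (x : X) :
    S.tabooOp u x ≤ S.tabooOp v x :=
  lintegral_mono h

lemma measurable_tabooOp {u : X → ℝ≥0∞} (hu : Measurable u) : Measurable (S.tabooOp u) := by
  have h : S.tabooOp u = fun x => S.bell x {false} * ∫⁻ y, u y ∂(S.residual x) :=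
    funext fun x => S.tabooOp_eq u x
  rw [h]
  exact (S.bell.measurable_coe (measurableSet_singleton _)).mul hu.lintegral_kernel

lemma tabooOp_add_bell_mul [IsMarkovKernel P] (u : X → ℝ≥0∞) (x : X) :
    S.tabooOp u x + S.bell x {true} * ∫⁻ y, u y ∂S.ν = ∫⁻ y, u y ∂(P x) := by
  rw [← S.taboo_add_bell_smul x, lintegral_add_measure, lintegral_smul_measure, smul_eq_mul,
    tabooOp]

lemma measurable_tabooOp_iterate {u : X → ℝ≥0∞} (hu : Measurable u) (n : ℕ) :
    Measurable (S.tabooOp^[n] u) := by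
  induction n with
  | zero => exact hu
  | succ n ih => rw [Function.iterate_succ_apply']; exact S.measurable_tabooOp ih

/-- The Green operator `u ↦ (x ↦ E_x ∑_{i < T} u(X_i))` of the chain killed at regeneration. -/
def green (u : X → ℝ≥0∞) (x : X) : ℝ≥0∞ := ∑' n, S.tabooOp^[n] u x

lemma measurable_green {u : X → ℝ≥0∞} (hu : Measurable u) : Measurable (S.green u) :=
  Measurable.tsum fun n => S.measurable_tabooOp_iterate hu n

/-- Split off the term n = 0 of the series and move one factor of the operator outside the sum by
monotone convergence. -/
lemma green_eq_add {u : X → ℝ≥0∞} (hu : Measurable u) (x : X) :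
    S.green u x = u x + S.tabooOp (S.green u) x := by
  have h : S.green u = fun x => ∑' n, S.tabooOp^[n] u x := rfl
  rw [green, tsum_eq_zero_add' ENNReal.summable, h, tabooOp,
    lintegral_tsum fun n => (S.measurable_tabooOp_iterate hu n).aemeasurable]
  simp only [Function.iterate_zero, id, Function.iterate_succ_apply']
  rfl

lemma green_mono {u v : X → ℝ≥0∞} (h : ∀ x, u x ≤ v x) (x : X) : S.green u x ≤ S.green v x := by
  refine ENNReal.tsum_le_tsum fun n => ?_
  induction n generalizing x with
  | zero => exact h x
  | succ n ih =>
    rw [Function.iterate_succ_apply', Function.iterate_succ_apply']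
    exact S.tabooOp_mono ih x

/-- The Green operator gives the least nonnegative solution of the Poisson inequality. -/
lemma green_le_of_add_tabooOp_le {u w : X → ℝ≥0∞} (hu : Measurable u)
    (h : ∀ x, u x + S.tabooOp w x ≤ w x) (x : X) : S.green u x ≤ w x := by
  rw [green, ENNReal.tsum_eq_iSup_nat]
  refine iSup_le fun n => ?_
  induction n generalizing x with
  | zero => simp
  | succ n ih =>
    -- The partial sums satisfy s_{n+1} = u + K s_n, so s_n ≤ w propagates to s_{n+1} ≤ u + K w ≤ w.
    rw [Finset.sum_range_succ']
    refine le_trans (le_of_eq ?_) (h x |>.trans' (add_le_add le_rfl (S.tabooOp_mono ih x)))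
    simp only [tabooOp]
    rw [lintegral_finsetSum _ fun n _ => S.measurable_tabooOp_iterate hu n, add_comm]
    simp only [Function.iterate_succ_apply']
    rfl

lemma green_const_mul {u : X → ℝ≥0∞} (hu : Measurable u) (c : ℝ≥0∞) (x : X) :
    S.green (fun y => c * u y) x = c * S.green u x := by
  rw [green, green, ← ENNReal.tsum_mul_left]
  congr with n
  have : ∀ x, S.tabooOp^[n] (fun y => c * u y) x = c * S.tabooOp^[n] u x := by
    induction n with
    | zero => intro x; rfl
    | succ n ih =>
      intro x
      rw [Function.iterate_succ_apply', Function.iterate_succ_apply', funext ih, tabooOp,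
        lintegral_const_mul _ (S.measurable_tabooOp_iterate hu n), tabooOp]
  exact this x

lemma green_add {u v : X → ℝ≥0∞} (hu : Measurable u) (x : X) :
    S.green (fun y => u y + v y) x = S.green u x + S.green v x := by
  rw [green, green, green, ← ENNReal.tsum_add]
  congr with n
  have : ∀ x, S.tabooOp^[n] (fun y => u y + v y) x
      = S.tabooOp^[n] u x + S.tabooOp^[n] v x := by
    induction n with
    | zero => intro x; rfl
    | succ n ih =>
      intro x
      rw [Function.iterate_succ_apply', Function.iterate_succ_apply',
        Function.iterate_succ_apply', funext ih, tabooOp,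
        lintegral_add_left (S.measurable_tabooOp_iterate hu n), tabooOp, tabooOp]
  exact this x

lemma move_true (x : X) : S.move (x, true) = S.ν := by
  simp [move, Kernel.piecewise_apply]

lemma move_false (x : X) : S.move (x, false) = S.residual x := by
  simp [move, Kernel.piecewise_apply]

end Taboo

/-! ### First step analysis and time shifts of the split chain -/

section FirstStep

variable {X : Type*} [MeasurableSpace X] {P : Kernel X X} [IsMarkovKernel P] {π : Measure X}
  (S : SmallSet P π)

instance (ξ : Measure X) [IsProbabilityMeasure ξ] : IsProbabilityMeasure (S.law ξ) := by
  unfold law; infer_instance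

/-- The expectation of a path functional of the split chain as a function of the starting
position. -/
def expect (F : (ℕ → X × Bool) → ℝ≥0∞) (x : X) : ℝ≥0∞ :=
  ∫⁻ γ, ∫⁻ ω, F ω ∂(chainKernel S.splitKernel (x, γ)) ∂(S.bell x)

lemma measurable_expect {F : (ℕ → X × Bool) → ℝ≥0∞} (hF : Measurable F) :
    Measurable (S.expect F) := by
  have h : Measurable fun z => ∫⁻ ω, F ω ∂(chainKernel S.splitKernel z) := hF.lintegral_kernel
  exact Measurable.lintegral_kernel_prod_right h

lemma lintegral_law (ξ : Measure X) [SFinite ξ] {F : (ℕ → X × Bool) → ℝ≥0∞}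
    (hF : Measurable F) : ∫⁻ ω, F ω ∂(S.law ξ) = ∫⁻ x, S.expect F x ∂ξ := by
  rw [law, chainLaw_eq_bind, Measure.lintegral_bind (Kernel.aemeasurable _) hF.aemeasurable,
    Measure.lintegral_compProd hF.lintegral_kernel]
  rfl

/-- The bell of a new position is drawn from that position alone, so the chain after one step is
again a split chain, started from the law of the move. -/
lemma chainLaw_splitKernel_apply (z : X × Bool) :
    chainLaw S.splitKernel (S.splitKernel z) = S.law (S.move z) := by
  rw [law]
  congr 1
  ext s hs
  rw [splitKernel, Kernel.compProd_apply hs, Measure.compProd_apply hs]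
  rfl

lemma expect_eq_lintegral_law {F : (ℕ → X × Bool) → ℝ≥0∞} (hF : Measurable F) (x : X) :
    S.expect F x = ∫⁻ ω, F ω ∂(S.law (Measure.dirac x)) := by
  rw [S.lintegral_law _ hF, lintegral_dirac' _ (S.measurable_expect hF)]

/-- First step decomposition for the split chain. -/
lemma expect_first_step {G : (X × Bool) × (ℕ → X × Bool) → ℝ≥0∞} (hG : Measurable G) (x : X) :
    S.expect (fun ω => G (ω 0, fun n => ω (n + 1))) x
      = S.bell x {true} * ∫⁻ y, S.expect (fun ω => G ((x, true), ω)) y ∂S.ν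
        + S.bell x {false} * ∫⁻ y, S.expect (fun ω => G ((x, false), ω)) y ∂(S.residual x) := by
  have hm : Measurable fun z => ∫⁻ ω, G (z, ω) ∂(chainLaw S.splitKernel (S.splitKernel z)) := by
    simp only [← comp_apply_eq_chainLaw]
    exact Measurable.lintegral_kernel_prod_right
      (κ := chainKernel S.splitKernel ∘ₖ S.splitKernel) hG
  have hG' : ∀ z, Measurable fun ω => G (z, ω) := fun z => hG.comp measurable_prodMk_left
  rw [S.expect_eq_lintegral_law (by fun_prop), law, lintegral_chainLaw_first_step _ _ hG,
    Measure.lintegral_compProd hm,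
    lintegral_dirac' _ (Measurable.lintegral_kernel_prod_right hm), lintegral_bell,
    chainLaw_splitKernel_apply, chainLaw_splitKernel_apply, move_true, move_false,
    S.lintegral_law _ (hG' _), S.lintegral_law _ (hG' _)]

/-- Averaging over the bell recombines ν and the residual kernel into P, so the position after one
step has law P(x, ·). -/
lemma expect_shift {F : (ℕ → X × Bool) → ℝ≥0∞} (hF : Measurable F) (x : X) :
    S.expect (fun ω => F (fun n => ω (n + 1))) x = ∫⁻ y, S.expect F y ∂(P x) := by
  rw [S.expect_first_step (G := fun p => F p.2) (hF.comp measurable_snd),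
    ← S.tabooOp_add_bell_mul, tabooOp_eq, add_comm]

lemma lintegral_law_shift (ξ : Measure X) [IsProbabilityMeasure ξ]
    {F : (ℕ → X × Bool) → ℝ≥0∞} (hF : Measurable F) (n : ℕ) :
    ∫⁻ ω, F (fun i => ω (n + i)) ∂(S.law ξ)
      = ∫⁻ ω, F ω ∂(S.law (ξ.bind (P ^ n : Kernel X X))) := by
  induction n generalizing F with
  | zero =>
    have : (ξ.bind (P ^ 0 : Kernel X X)) = ξ := by
      rw [pow_zero]; exact Measure.bind_dirac
    rw [this]; simp
  | succ n ih =>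
    have hF' : Measurable fun ω : ℕ → X × Bool => F (fun i => ω (i + 1)) := by fun_prop
    have h := ih hF'
    simp only [← add_assoc] at h
    simp only [add_right_comm n 1]
    have := isMarkovKernel_pow P n
    have := isMarkovKernel_pow P (n + 1)
    rw [h, S.lintegral_law _ hF', S.lintegral_law _ hF,
      lintegral_congr fun x => S.expect_shift hF x,
      Measure.lintegral_bind (Kernel.aemeasurable _)
        (S.measurable_expect hF).lintegral_kernel.aemeasurable,
      Measure.lintegral_bind (Kernel.aemeasurable _) (S.measurable_expect hF).aemeasurable]
    refine lintegral_congr fun x => ?_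
    rw [pow_succ']
    exact (Kernel.lintegral_comp P (P ^ n : Kernel X X) x (S.measurable_expect hF)).symm

end FirstStep

end SmallSet

/-! ### Block sums as functionals of the path -/

section Paths

variable {X : Type*}

/-- A bell at time j produces the regeneration time j + 1, hence the strict range j < i. -/
lemma lt_regenTime_one_iff (ω : ℕ → X × Bool) (i : ℕ) :
    (i : ℕ∞) < regenTime ω 1 ↔ ∀ j < i, (ω j).2 = false := by
  constructor
  · intro h j hj
    by_contra hne
    have hle : regenTime ω 1 ≤ ((j + 1 : ℕ) : ℕ∞) := by
      have hpos : regenTime ω 0 < ((j + 1 : ℕ) : ℕ∞) := by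
        change ((0 : ℕ) : ℕ∞) < _
        exact_mod_cast Nat.succ_pos j
      exact sInf_le ⟨j + 1, rfl, hpos, by simpa using hne⟩
    have : i < j + 1 := by exact_mod_cast h.trans_le hle
    omega
  · intro h
    have hle : ((i + 1 : ℕ) : ℕ∞) ≤ regenTime ω 1 := by
      refine le_sInf ?_
      rintro _ ⟨n, rfl, hn, hn'⟩
      have hn0 : 0 < n := by
        have : ((0 : ℕ) : ℕ∞) < n := hn
        exact_mod_cast this
      by_contra hlt
      have hlt' : n < i + 1 := by exact_mod_cast not_le.1 hlt
      have := h (n - 1) (by omega)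
      simp [this] at hn'
    exact lt_of_lt_of_le (by exact_mod_cast Nat.lt_succ_self i) hle

/-- The summand `1(i < T) u(X_i)` of the first block sum of a nonnegative function. -/
def blockTerm (u : X → ℝ≥0∞) (i : ℕ) (ω : ℕ → X × Bool) : ℝ≥0∞ :=
  if ∀ j < i, (ω j).2 = false then u (ω i).1 else 0

/-- The first block sum of a nonnegative function, truncated at time `n`. -/
def blockPartialSum (u : X → ℝ≥0∞) (n : ℕ) (ω : ℕ → X × Bool) : ℝ≥0∞ :=
  ∑ i ∈ Finset.range n, blockTerm u i ω

/-- The first block sum of a nonnegative function. -/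
def blockTotal (u : X → ℝ≥0∞) (ω : ℕ → X × Bool) : ℝ≥0∞ := ∑' i, blockTerm u i ω

lemma blockTerm_succ (u : X → ℝ≥0∞) (i : ℕ) (ω : ℕ → X × Bool) :
    blockTerm u (i + 1) ω = if (ω 0).2 then 0 else blockTerm u i fun n => ω (n + 1) := by
  have h : (∀ j < i + 1, (ω j).2 = false) ↔ (ω 0).2 = false ∧ ∀ j < i, (ω (j + 1)).2 = false :=
    Nat.forall_lt_succ_left
  unfold blockTerm
  rw [if_congr h rfl rfl]
  cases h0 : (ω 0).2 <;> simp

lemma blockPartialSum_succ (u : X → ℝ≥0∞) (n : ℕ) (ω : ℕ → X × Bool) :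
    blockPartialSum u (n + 1) ω
      = u (ω 0).1 + if (ω 0).2 then 0 else blockPartialSum u n fun n => ω (n + 1) := by
  have h0 : blockTerm u 0 ω = u (ω 0).1 := by simp [blockTerm]
  rw [blockPartialSum, Finset.sum_range_succ', add_comm, h0]
  simp only [blockTerm_succ]
  cases (ω 0).2 <;> simp [blockPartialSum]

lemma absSum_zero_eq_blockTotal (g : X → ℝ) (ω : ℕ → X × Bool) :
    absSum g ω 0 (regenTime ω 1) = blockTotal (fun x => ENNReal.ofReal |g x|) ω := by
  unfold absSum blockTotal blockTerm
  refine tsum_congr fun i => ?_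
  simp only [Nat.zero_le, true_and, lt_regenTime_one_iff]

lemma regenTime_one_eq_blockTotal (ω : ℕ → X × Bool) :
    ((regenTime ω 1 : ℕ∞) : ℝ≥0∞) = blockTotal 1 ω := by
  unfold blockTotal blockTerm
  simp only [← lt_regenTime_one_iff, Pi.one_apply]
  generalize regenTime ω 1 = t
  induction t using ENat.recTopCoe with
  | top => simp
  | coe n =>
    rw [tsum_eq_sum (s := Finset.range n) fun i hi => by simpa using hi]
    simp +contextual [Finset.filter_true_of_mem]

/-- The triangle inequality. It covers T = ∞ as well, since `toNat` then makes the real block sum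
empty. -/
lemma ofReal_blockSum_sq_le (g : X → ℝ) (ω : ℕ → X × Bool) :
    ENNReal.ofReal (blockSum g ω ^ 2) ≤ blockTotal (fun x => ENNReal.ofReal |g x|) ω ^ 2 := by
  rw [← sq_abs, ENNReal.ofReal_pow (abs_nonneg _)]
  refine pow_le_pow_left' ?_ 2
  rw [blockSum]
  calc ENNReal.ofReal |∑ i ∈ Finset.range (regenTime ω 1).toNat, g (ω i).1|
      ≤ ENNReal.ofReal (∑ i ∈ Finset.range (regenTime ω 1).toNat, |g (ω i).1|) :=
        ENNReal.ofReal_le_ofReal (Finset.abs_sum_le_sum_abs _ _)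
    _ = ∑ i ∈ Finset.range (regenTime ω 1).toNat, ENNReal.ofReal |g (ω i).1| :=
        ENNReal.ofReal_sum_of_nonneg fun _ _ => abs_nonneg _
    _ = ∑ i ∈ Finset.range (regenTime ω 1).toNat,
          blockTerm (fun x => ENNReal.ofReal |g x|) i ω := by
        refine Finset.sum_congr rfl fun i hi => ?_
        have hlt : (i : ℕ∞) < regenTime ω 1 := by
          rcases eq_or_ne (regenTime ω 1) ⊤ with h | h
          · simp [h]
          · rw [← ENat.natCast_toNat h]; exact_mod_cast Finset.mem_range.1 hi
        rw [blockTerm, if_pos ((lt_regenTime_one_iff ω i).1 hlt)]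
    _ ≤ _ := ENNReal.sum_le_tsum _

/-- The sum from `n` to the end of the current block is at most the first block sum of the path
shifted by `n`. -/
lemma absSum_regenIndex_le (g : X → ℝ) (ω : ℕ → X × Bool) (n : ℕ) :
    absSum g ω n (regenTime ω (regenIndex ω n))
      ≤ blockTotal (fun x => ENNReal.ofReal |g x|) fun i => ω (n + i) := by
  have hbell : ∀ i : ℕ, (i : ℕ∞) < regenTime ω (regenIndex ω n) → ∀ j, n ≤ j → j < i →
      (ω j).2 = false := by
    intro i hi j hnj hji
    -- The index 0 would be the default value of `sInf`; as T_0 = 0, no i lies below it. Otherwise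
    -- minimality of R(n) = r + 1 gives T_r ≤ n, so a bell at time j ≥ n would force T_{r+1} ≤ j +
    -- 1.
    rcases hr : regenIndex ω n with _ | r
    · rw [hr] at hi
      exact absurd hi (not_lt.2 (zero_le))
    · rw [hr] at hi
      have hrn : regenTime ω r ≤ n := by
        rcases Nat.eq_zero_or_pos r with h0 | h0
        · rw [h0]; exact zero_le
        · have : r ∉ {r : ℕ | 1 ≤ r ∧ (n : ℕ∞) < regenTime ω r} :=
            Nat.notMem_of_lt_sInf (by rw [← regenIndex, hr]; exact Nat.lt_succ_self r)
          simpa [h0, Nat.one_le_iff_ne_zero, h0.ne'] using this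
      by_contra hne
      have hle : regenTime ω (r + 1) ≤ ((j + 1 : ℕ) : ℕ∞) := by
        refine sInf_le ⟨j + 1, rfl, hrn.trans_lt ?_, by simpa using hne⟩
        exact_mod_cast Nat.lt_succ_of_le hnj
      have : i < j + 1 := by exact_mod_cast hi.trans_le hle
      omega
  unfold absSum blockTotal
  refine (Summable.sum_add_tsum_nat_add' (k := n) ENNReal.summable).symm.trans_le ?_
  rw [Finset.sum_eq_zero, zero_add]
  · refine ENNReal.tsum_le_tsum fun i => ?_
    split_ifs with h
    · rw [blockTerm, if_pos fun j hj => hbell _ h.2 _ (Nat.le_add_right _ _) (by omega), add_comm]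
    · exact zero_le
  · intro i hi
    have := Finset.mem_range.1 hi
    rw [if_neg (by omega)]

lemma blockTotal_eq_iSup (u : X → ℝ≥0∞) (ω : ℕ → X × Bool) :
    blockTotal u ω = ⨆ n, blockPartialSum u n ω :=
  ENNReal.tsum_eq_iSup_nat

lemma monotone_blockPartialSum (u : X → ℝ≥0∞) (ω : ℕ → X × Bool) :
    Monotone fun n => blockPartialSum u n ω := fun _ _ h =>
  Finset.sum_le_sum_of_subset (Finset.range_mono h)

variable [MeasurableSpace X]

lemma measurable_blockTerm {u : X → ℝ≥0∞} (hu : Measurable u) (i : ℕ) :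
    Measurable (blockTerm u i) := by
  refine Measurable.ite ?_ (by fun_prop) measurable_const
  have : {ω : ℕ → X × Bool | ∀ j < i, (ω j).2 = false}
      = ⋂ j, ⋂ (_ : j < i), (fun ω : ℕ → X × Bool => (ω j).2) ⁻¹' {false} := by
    ext; simp
  rw [this]
  exact MeasurableSet.iInter fun j => MeasurableSet.iInter fun _ =>
    (by fun_prop : Measurable fun ω : ℕ → X × Bool => (ω j).2) (measurableSet_singleton _)

lemma measurable_blockPartialSum {u : X → ℝ≥0∞} (hu : Measurable u) (n : ℕ) :
    Measurable (blockPartialSum u n) :=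
  Finset.measurable_fun_sum _ fun i _ => measurable_blockTerm hu i

lemma measurable_blockTotal {u : X → ℝ≥0∞} (hu : Measurable u) :
    Measurable (blockTotal u) :=
  Measurable.tsum fun i => measurable_blockTerm hu i

end Paths

/-! ### First and second moments of block sums -/

namespace SmallSet

variable {X : Type*} [MeasurableSpace X] {P : Kernel X X} [IsMarkovKernel P] {π : Measure X}
  (S : SmallSet P π)

/-- First step decomposition of a functional `a(u(X_0)) + 1(Γ_0 = 0) F(u(X_0), θ ω)`, where `θ` is
the shift. -/
lemma expect_add_ite (a : ℝ≥0∞ → ℝ≥0∞) {u : X → ℝ≥0∞} (hu : Measurable u)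
    (ha : Measurable a) {F : ℝ≥0∞ → (ℕ → X × Bool) → ℝ≥0∞} (hF : Measurable F.uncurry) (x : X) :
    S.expect (fun ω => a (u (ω 0).1) +
        if (ω 0).2 then 0 else F (u (ω 0).1) fun n => ω (n + 1)) x
      = a (u x) + S.tabooOp (S.expect (F (u x))) x := by
  have hG : Measurable fun p : (X × Bool) × (ℕ → X × Bool) =>
      a (u p.1.1) + if p.1.2 then 0 else F (u p.1.1) p.2 := by
    refine (by fun_prop : Measurable fun p : (X × Bool) × (ℕ → X × Bool) => a (u p.1.1)).add
      (Measurable.ite ?_ measurable_const ?_)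
    · exact (by fun_prop : Measurable fun p : (X × Bool) × (ℕ → X × Bool) => p.1.2)
        (measurableSet_singleton true)
    · exact hF.comp (by fun_prop : Measurable fun p : (X × Bool) × (ℕ → X × Bool) =>
        (u p.1.1, p.2))
  have hFx : Measurable (F (u x)) := hF.comp measurable_prodMk_left
  have hc : ∀ (c : ℝ≥0∞) (y : X), S.expect (fun _ => c) y = c := by
    intro c y; simp only [expect, lintegral_const, measure_univ, mul_one]
  have hadd : ∀ y, S.expect (fun ω => a (u x) + F (u x) ω) y
      = a (u x) + S.expect (F (u x)) y := by
    intro y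
    rw [S.expect_eq_lintegral_law (by fun_prop), lintegral_add_left measurable_const,
      ← S.expect_eq_lintegral_law hFx]
    simp
  rw [S.expect_first_step hG]
  simp only [if_true, add_zero, Bool.false_eq_true, if_false, hc, hadd]
  rw [lintegral_add_left measurable_const, tabooOp_eq]
  simp only [lintegral_const, measure_univ, mul_one]
  rw [mul_add, ← add_assoc, ← add_mul, S.bell_true_add_false, one_mul]

/-- Each step contributes one factor of the taboo operator, because the term survives only if the
current bell is silent. -/
lemma expect_blockTerm {u : X → ℝ≥0∞} (hu : Measurable u) (i : ℕ) (x : X) :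
    S.expect (blockTerm u i) x = S.tabooOp^[i] u x := by
  induction i generalizing x with
  | zero =>
    have h := S.expect_add_ite id hu measurable_id (F := fun _ _ => 0) measurable_const x
    have e : blockTerm u 0 = fun ω => u (ω 0).1 := by ext ω; simp [blockTerm]
    rw [e]
    simpa [tabooOp, expect] using h
  | succ i ih =>
    have h := S.expect_add_ite (fun _ => 0) hu measurable_const (F := fun _ => blockTerm u i)
      ((measurable_blockTerm hu i).comp measurable_snd) x
    simp only [zero_add] at h
    rw [Function.iterate_succ_apply', ← funext ih, ← h]
    congr 1
    ext ω
    exact blockTerm_succ u i ω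

lemma lintegral_blockTotal (ξ : Measure X) [SFinite ξ] {u : X → ℝ≥0∞} (hu : Measurable u) :
    ∫⁻ ω, blockTotal u ω ∂(S.law ξ) = ∫⁻ x, S.green u x ∂ξ := by
  rw [S.lintegral_law ξ (measurable_blockTotal hu)]
  refine lintegral_congr fun x => ?_
  rw [S.expect_eq_lintegral_law (measurable_blockTotal hu)]
  unfold blockTotal
  rw [lintegral_tsum fun i => (measurable_blockTerm hu i).aemeasurable]
  refine tsum_congr fun i => ?_
  rw [← S.expect_eq_lintegral_law (measurable_blockTerm hu i), S.expect_blockTerm hu]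

lemma meanT_eq (ξ : Measure X) [SFinite ξ] : S.meanT ξ = ∫⁻ x, S.green 1 x ∂ξ := by
  rw [meanT, ← S.lintegral_blockTotal ξ measurable_one]
  exact lintegral_congr fun ω => regenTime_one_eq_blockTotal ω

lemma expect_blockPartialSum_le {u : X → ℝ≥0∞} (hu : Measurable u) (n : ℕ) (x : X) :
    S.expect (blockPartialSum u n) x ≤ S.green u x := by
  have hm := measurable_blockPartialSum hu n
  rw [S.expect_eq_lintegral_law hm]
  have h := S.lintegral_blockTotal (Measure.dirac x) hu
  rw [lintegral_dirac' _ (S.measurable_green hu)] at h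
  rw [← h]
  exact lintegral_mono fun ω => ENNReal.sum_le_tsum _

/-- The function `u² + 2 u (G u - u)`, whose Green potential is the second moment of the block
sum. -/
def secondMoment (u : X → ℝ≥0∞) (x : X) : ℝ≥0∞ :=
  u x ^ 2 + 2 * u x * S.tabooOp (S.green u) x

omit [IsMarkovKernel P] in
lemma measurable_secondMoment {u : X → ℝ≥0∞} (hu : Measurable u) :
    Measurable (S.secondMoment u) := by
  have := S.measurable_tabooOp (S.measurable_green hu)
  unfold secondMoment
  fun_prop

/-- With Ξ = u(X_0) + 1(Γ_0 = 0) Ξ', the cross term 2u(X_0)Ξ' is controlled by the first moment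
bound and Ξ'² by induction. The sum of these bounds is the equation G h = h + K G h for h =
`secondMoment u`. Truncation at n supplies the base of the induction. -/
lemma expect_blockPartialSum_sq_le {u : X → ℝ≥0∞} (hu : Measurable u) (n : ℕ) (x : X) :
    S.expect (fun ω => blockPartialSum u n ω ^ 2) x ≤ S.green (S.secondMoment u) x := by
  induction n generalizing x with
  | zero => simp [blockPartialSum, expect]
  | succ n ih =>
    have hm := measurable_blockPartialSum hu n
    have h := S.expect_add_ite (fun t => t ^ 2) hu (by fun_prop)
      (F := fun t ω => 2 * t * blockPartialSum u n ω + blockPartialSum u n ω ^ 2)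
      (by unfold Function.uncurry; fun_prop) x
    have e : (fun ω => blockPartialSum u (n + 1) ω ^ 2) = fun ω : ℕ → X × Bool =>
        u (ω 0).1 ^ 2 + if (ω 0).2 then 0 else
          2 * u (ω 0).1 * blockPartialSum u n (fun n => ω (n + 1))
            + blockPartialSum u n (fun n => ω (n + 1)) ^ 2 := by
      ext ω
      rw [blockPartialSum_succ]
      cases (ω 0).2
      · simp only [Bool.false_eq_true, if_false]; ring
      · simp
    have e2 : ∀ y, S.expect (fun ω => 2 * u x * blockPartialSum u n ω
          + blockPartialSum u n ω ^ 2) y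
        ≤ 2 * u x * S.green u y + S.green (S.secondMoment u) y := by
      intro y
      rw [S.expect_eq_lintegral_law (by fun_prop), lintegral_add_right _ (by fun_prop),
        lintegral_const_mul _ hm, ← S.expect_eq_lintegral_law hm,
        ← S.expect_eq_lintegral_law (by fun_prop)]
      gcongr
      · exact S.expect_blockPartialSum_le hu n y
      · exact ih y
    rw [e, h, S.green_eq_add (S.measurable_secondMoment hu), secondMoment, add_assoc]
    gcongr
    refine (S.tabooOp_mono e2 x).trans (le_of_eq ?_)
    rw [tabooOp, lintegral_add_left ((S.measurable_green hu).const_mul _),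
      lintegral_const_mul _ (S.measurable_green hu), tabooOp, tabooOp]

lemma lintegral_blockTotal_sq_le (ξ : Measure X) [SFinite ξ] {u : X → ℝ≥0∞}
    (hu : Measurable u) :
    ∫⁻ ω, blockTotal u ω ^ 2 ∂(S.law ξ) ≤ ∫⁻ x, S.green (S.secondMoment u) x ∂ξ := by
  have hm := fun n => (measurable_blockPartialSum hu n).pow_const 2
  have e : ∀ ω : ℕ → X × Bool, blockTotal u ω ^ 2 = ⨆ n, blockPartialSum u n ω ^ 2 := by
    intro ω
    rw [blockTotal_eq_iSup]
    exact (ENNReal.iSup_pow _ _)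
  rw [lintegral_congr e, lintegral_iSup hm
    fun n m h ω => pow_le_pow_left' (monotone_blockPartialSum u ω h) 2]
  refine iSup_le fun n => ?_
  rw [S.lintegral_law ξ (hm n)]
  exact lintegral_mono fun x => S.expect_blockPartialSum_sq_le hu n x

end SmallSet

/-! ### Drift conditions -/

section Integrals

variable {X : Type*} [MeasurableSpace X]

lemma integrable_of_one_le_of_lintegral_ne_top {ρ : Measure X} {U : X → ℝ} (hU : Measurable U)
    (h1 : ∀ x, 1 ≤ U x) (h : ∫⁻ x, ENNReal.ofReal (U x) ∂ρ ≠ ∞) : Integrable U ρ :=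
  (lintegral_ofReal_ne_top_iff_integrable hU.aestronglyMeasurable
    (ae_of_all _ fun x => zero_le_one.trans (h1 x))).1 h

lemma integrable_sqrt {ρ : Measure X} {U : X → ℝ} (hU : Measurable U)
    (h1 : ∀ x, 1 ≤ U x) (h : Integrable U ρ) : Integrable (fun x => √(U x)) ρ := by
  refine h.mono' hU.sqrt.aestronglyMeasurable (ae_of_all _ fun x => ?_)
  rw [Real.norm_of_nonneg (Real.sqrt_nonneg _)]
  exact Real.sqrt_le_iff.2 ⟨by linarith [h1 x], by nlinarith [h1 x]⟩

lemma integral_le_of_lintegral_le {ρ : Measure X} {U : X → ℝ} (hU : Measurable U)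
    (h1 : ∀ x, 1 ≤ U x) {M : ℝ} (hM : 0 ≤ M)
    (h : ∫⁻ x, ENNReal.ofReal (U x) ∂ρ ≤ ENNReal.ofReal M) : ∫ x, U x ∂ρ ≤ M := by
  rw [integral_eq_lintegral_of_nonneg_ae (ae_of_all _ fun x => zero_le_one.trans (h1 x))
    hU.aestronglyMeasurable]
  exact ENNReal.toReal_le_of_le_ofReal hM h

lemma one_le_of_lintegral_le {ρ : Measure X} [IsProbabilityMeasure ρ] {U : X → ℝ}
    (h1 : ∀ x, 1 ≤ U x) {M : ℝ} (h : ∫⁻ x, ENNReal.ofReal (U x) ∂ρ ≤ ENNReal.ofReal M) :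
    1 ≤ M := by
  have : (1 : ℝ≥0∞) ≤ ∫⁻ x, ENNReal.ofReal (U x) ∂ρ := by
    calc (1 : ℝ≥0∞) = ∫⁻ _, 1 ∂ρ := by simp
      _ ≤ _ := lintegral_mono fun x => by simpa using h1 x
  simpa using this.trans h

/-- Jensen's inequality for the square root. -/
lemma lintegral_sqrt_le {ρ : Measure X} [IsProbabilityMeasure ρ] {U : X → ℝ}
    (hU : Measurable U) (h1 : ∀ x, 1 ≤ U x) {M : ℝ}
    (h : ∫⁻ x, ENNReal.ofReal (U x) ∂ρ ≤ ENNReal.ofReal M) :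
    ∫⁻ x, ENNReal.ofReal √(U x) ∂ρ ≤ ENNReal.ofReal √M := by
  have hM := one_le_of_lintegral_le h1 h
  have hi := integrable_of_one_le_of_lintegral_ne_top hU h1 (h.trans_lt ENNReal.ofReal_lt_top).ne
  have hle := integral_le_of_lintegral_le hU h1 (zero_le_one.trans hM) h
  have hs := integrable_sqrt hU h1 hi
  have hM0 : 0 < √M := Real.sqrt_pos.2 (by linarith)
  rw [← ofReal_integral_eq_lintegral_ofReal hs (ae_of_all _ fun x => Real.sqrt_nonneg _)]
  refine ENNReal.ofReal_le_ofReal ?_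
  -- Integrating this tangent inequality gives 2√M ∫√U ≤ ∫U + M ≤ 2M, and dividing by 2√M > 0 gives
  -- the claim.
  have hpt : ∀ x, 2 * √M * √(U x) ≤ U x + M := by
    intro x
    nlinarith [sq_nonneg (√M - √(U x)), Real.sq_sqrt (show 0 ≤ M by linarith),
      Real.sq_sqrt (show 0 ≤ U x by linarith [h1 x])]
  have := integral_mono (hs.const_mul (2 * √M)) (hi.add (integrable_const M)) hpt
  simp only [Pi.add_apply] at this
  rw [integral_const_mul, integral_add hi (integrable_const M)] at this
  simp only [integral_const, probReal_univ, smul_eq_mul, one_mul] at this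
  nlinarith [Real.sq_sqrt (show 0 ≤ M by linarith)]

lemma lintegral_ofReal_combination {ρ : Measure X} [IsProbabilityMeasure ρ] {U W : X → ℝ}
    (hU : Integrable U ρ) (hW : Integrable W ρ) {p q r : ℝ}
    (h : ∀ x, 0 ≤ p * U x + q * W x + r) :
    0 ≤ p * ∫ x, U x ∂ρ + q * ∫ x, W x ∂ρ + r ∧
    ∫⁻ x, ENNReal.ofReal (p * U x + q * W x + r) ∂ρ
      = ENNReal.ofReal (p * ∫ x, U x ∂ρ + q * ∫ x, W x ∂ρ + r) := by
  have hi : Integrable (fun x => p * U x + q * W x) ρ := (hU.const_mul p).add (hW.const_mul q)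
  have e : ∫ x, (p * U x + q * W x + r) ∂ρ = p * ∫ x, U x ∂ρ + q * ∫ x, W x ∂ρ + r := by
    rw [integral_add hi (integrable_const r), integral_add (hU.const_mul p) (hW.const_mul q),
      integral_const_mul, integral_const_mul]
    simp
  rw [← e]
  exact ⟨integral_nonneg h, (ofReal_integral_eq_lintegral_ofReal
    (hi.add (integrable_const r)) (ae_of_all _ h)).symm⟩

end Integrals

lemma coe_le_coe_of_le_ofReal {a : ℝ≥0∞} {r : ℝ} (hr : 0 ≤ r) (h : a ≤ ENNReal.ofReal r) :
    (a : EReal) ≤ (r : EReal) := by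
  have := EReal.coe_ennreal_le_coe_ennreal_iff.2 h
  rwa [EReal.coe_ennreal_ofReal, max_eq_left hr] at this

namespace SmallSet

section Drift

variable {X : Type*} [MeasurableSpace X] {P : Kernel X X} [IsMarkovKernel P] {π : Measure X}
  (S : SmallSet P π) {U : X → ℝ} {l k : ℝ}

/-- At a point x of J, βν ≤ P(x, ·), and U is integrable for P(x, ·). -/
lemma integrable_ν_of_drift (hU : Measurable U) (h1 : ∀ x, 1 ≤ U x)
    (hon : ∀ x ∈ S.J, ∫⁻ y, ENNReal.ofReal (U y) ∂(P x) ≤ ENNReal.ofReal k) :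
    Integrable U S.ν := by
  obtain ⟨x, hx⟩ := S.nonempty_J
  have hi := integrable_of_one_le_of_lintegral_ne_top hU h1
    ((hon x hx).trans_lt ENNReal.ofReal_lt_top).ne
  rw [← S.taboo_add_smul hx] at hi
  exact (integrable_smul_measure (by simpa using S.β_pos) ENNReal.ofReal_ne_top).1
    (integrable_add_measure.1 hi).2

/-- Under a geometric drift condition for `U`, the Green potential of `U` is at most an affine
function of `U`. -/
lemma tabooOp_green_le_of_drift (hU : Measurable U) (h1 : ∀ x, 1 ≤ U x)
    (hl0 : 0 ≤ l) (hl1 : l < 1)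
    (hoff : ∀ x, x ∉ S.J → ∫⁻ y, ENNReal.ofReal (U y) ∂(P x) ≤ ENNReal.ofReal (l * U x))
    (hon : ∀ x ∈ S.J, ∫⁻ y, ENNReal.ofReal (U y) ∂(P x) ≤ ENNReal.ofReal k) (x : X) :
    0 ≤ l / (1 - l) * U x + (k - l - S.β) / (S.β * (1 - l)) ∧
    S.tabooOp (S.green fun y => ENNReal.ofReal (U y)) x
      ≤ ENNReal.ofReal (l / (1 - l) * U x + (k - l - S.β) / (S.β * (1 - l))) := by
  have hβ := S.β_pos
  have hβ1 := S.β_le_one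
  have hk : 1 ≤ k := by
    obtain ⟨z, hz⟩ := S.nonempty_J
    exact one_le_of_lintegral_le h1 (hon z hz)
  have hl : 0 < 1 - l := by linarith
  -- The comparison function is w = aU + b. Off J, a must satisfy 1 + al = a. On J, b must satisfy
  -- a(k - β) + b(1 - β) = al + b, that is bβ = a(k - l - β).
  set a := (1 - l)⁻¹ with ha
  have ha0 : 0 < a := inv_pos.2 hl
  have hal : a * (1 - l) = 1 := inv_mul_cancel₀ hl.ne'
  set b := (k - l - S.β) / (S.β * (1 - l)) with hb
  have hbβ : b * S.β = a * (k - l - S.β) := by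
    rw [hb, ha]; field_simp
  have hla : l / (1 - l) = a * l := by rw [ha]; field_simp
  -- The constant b may be negative; w is still nonnegative because U ≥ 1 and k ≥ 1 > l.
  have hW0 : ∀ y, 0 ≤ a * U y + b := by
    intro y
    have : 0 ≤ (a * U y + b) * S.β := by
      have e : (a * U y + b) * S.β = a * ((U y - 1) * S.β + (k - l)) := by rw [add_mul, hbβ]; ring
      rw [e]
      have := mul_nonneg (sub_nonneg.2 (h1 y)) hβ.le
      exact mul_nonneg ha0.le (by linarith)
    exact nonneg_of_mul_nonneg_left this hβ
  have hPi : ∀ z, Integrable U (P z) := by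
    intro z
    refine integrable_of_one_le_of_lintegral_ne_top hU h1 ?_
    by_cases hz : z ∈ S.J
    · exact ((hon z hz).trans_lt ENNReal.ofReal_lt_top).ne
    · exact ((hoff z hz).trans_lt ENNReal.ofReal_lt_top).ne
  have hνi := S.integrable_ν_of_drift hU h1 hon
  have hti : ∀ z, Integrable U (S.taboo z) := fun z => (hPi z).mono_measure (S.taboo_le z)
  have hWi : ∀ z, Integrable (fun y => a * U y + b) (S.taboo z) := fun z =>
    ((hti z).const_mul a).add (integrable_const b)
  have hWint : ∀ z, ∫ y, (a * U y + b) ∂(S.taboo z)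
      = a * ∫ y, U y ∂(S.taboo z) + b * (S.taboo z).real Set.univ := by
    intro z
    rw [integral_add ((hti z).const_mul a) (integrable_const b), integral_const_mul,
      integral_const, smul_eq_mul, mul_comm b]
  have hbound : ∀ z, ∫ y, (a * U y + b) ∂(S.taboo z) ≤ a * l * U z + b := by
    intro z
    rw [hWint]
    by_cases hz : z ∈ S.J
    · have hsplit := S.taboo_add_smul hz
      have hPle := integral_le_of_lintegral_le hU h1 (by linarith) (hon z hz)
      have hmass : (S.taboo z).real Set.univ = 1 - S.β := by
        have h := congrArg (fun ρ : Measure X => ρ.real Set.univ) hsplit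
        beta_reduce at h
        rw [measureReal_add_apply, measureReal_ennreal_smul_apply] at h
        simp only [probReal_univ, ENNReal.toReal_ofReal hβ.le, mul_one] at h
        linarith
      have hν1 : 1 ≤ ∫ y, U y ∂S.ν := by
        have := integral_mono (integrable_const (1 : ℝ)) hνi h1
        simpa using this
      have hint : ∫ y, U y ∂(S.taboo z) + S.β * ∫ y, U y ∂S.ν = ∫ y, U y ∂(P z) := by
        rw [← hsplit, integral_add_measure (hti z) (hνi.smul_measure ENNReal.ofReal_ne_top),
          integral_smul_measure, ENNReal.toReal_ofReal hβ.le, smul_eq_mul]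
      -- Removing βν removes at least β from the integral of U, since ν(U) ≥ 1.
      have hT : ∫ y, U y ∂(S.taboo z) ≤ k - S.β := by nlinarith
      rw [hmass]
      have h2 := mul_le_mul_of_nonneg_left hT ha0.le
      have h3 : a * l ≤ a * l * U z := le_mul_of_one_le_right (mul_nonneg ha0.le hl0) (h1 z)
      nlinarith
    · rw [S.taboo_of_notMem hz]
      have hPle := integral_le_of_lintegral_le hU h1
        (mul_nonneg hl0 (zero_le_one.trans (h1 z))) (hoff z hz)
      simp only [probReal_univ, mul_one]
      have := mul_le_mul_of_nonneg_left hPle ha0.le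
      linarith
  have hop : ∀ z, S.tabooOp (fun y => ENNReal.ofReal (a * U y + b)) z
      ≤ ENNReal.ofReal (a * l * U z + b) := by
    intro z
    rw [tabooOp, ← ofReal_integral_eq_lintegral_ofReal (hWi z) (ae_of_all _ hW0)]
    exact ENNReal.ofReal_le_ofReal (hbound z)
  have hnn : ∀ z, 0 ≤ a * l * U z + b := fun z => (integral_nonneg hW0).trans (hbound z)
  have hgreen : ∀ z, S.green (fun y => ENNReal.ofReal (U y)) z
      ≤ ENNReal.ofReal (a * U z + b) := by
    refine S.green_le_of_add_tabooOp_le hU.ennreal_ofReal fun z => ?_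
    refine (add_le_add le_rfl (hop z)).trans ?_
    rw [← ENNReal.ofReal_add (zero_le_one.trans (h1 z)) (hnn z)]
    refine ENNReal.ofReal_le_ofReal (le_of_eq ?_)
    linear_combination (-U z) * hal
  rw [hla]
  exact ⟨hnn x, (S.tabooOp_mono hgreen x).trans (hop x)⟩

lemma green_le_of_drift (hU : Measurable U) (h1 : ∀ x, 1 ≤ U x)
    (hl0 : 0 ≤ l) (hl1 : l < 1)
    (hoff : ∀ x, x ∉ S.J → ∫⁻ y, ENNReal.ofReal (U y) ∂(P x) ≤ ENNReal.ofReal (l * U x))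
    (hon : ∀ x ∈ S.J, ∫⁻ y, ENNReal.ofReal (U y) ∂(P x) ≤ ENNReal.ofReal k) (x : X) :
    0 ≤ 1 / (1 - l) * U x + (k - l - S.β) / (S.β * (1 - l)) ∧
    S.green (fun y => ENNReal.ofReal (U y)) x
      ≤ ENNReal.ofReal (1 / (1 - l) * U x + (k - l - S.β) / (S.β * (1 - l))) := by
  obtain ⟨h0, h⟩ := S.tabooOp_green_le_of_drift hU h1 hl0 hl1 hoff hon x
  have hl : 1 - l ≠ 0 := by linarith
  have hUx : 0 ≤ U x := zero_le_one.trans (h1 x)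
  have e : 1 / (1 - l) * U x + (k - l - S.β) / (S.β * (1 - l))
      = U x + (l / (1 - l) * U x + (k - l - S.β) / (S.β * (1 - l))) := by
    have : 1 / (1 - l) = 1 + l / (1 - l) := by field_simp; ring
    rw [this]; ring
  rw [e, ENNReal.ofReal_add hUx h0, S.green_eq_add hU.ennreal_ofReal]
  exact ⟨add_nonneg hUx h0, add_le_add le_rfl h⟩

end Drift

/-! ### Kac's formula -/

section Kac

variable {X : Type*} [MeasurableSpace X] {P : Kernel X X} [IsMarkovKernel P] {π : Measure X}
  (S : SmallSet P π)

/-- Invariance π = πP combined with P = K + β 1_J ν; under π the bell rings with probability βπ(J).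
-/
lemma lintegral_invariant_eq (hinv : Kernel.Invariant P π) {u : X → ℝ≥0∞} (hu : Measurable u) :
    ∫⁻ x, u x ∂π = ∫⁻ x, S.tabooOp u x ∂π
      + ENNReal.ofReal S.β * π S.J * ∫⁻ x, u x ∂S.ν := by
  classical
  have hb : ∀ x, S.bell x {true} = S.J.indicator (fun _ => ENNReal.ofReal S.β) x := by
    intro x; rw [bell_true, Set.indicator_apply]
  calc ∫⁻ x, u x ∂π = ∫⁻ x, ∫⁻ y, u y ∂(P x) ∂π := by
        conv_lhs => rw [← hinv.def]
        exact Measure.lintegral_bind (Kernel.aemeasurable _) hu.aemeasurable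
    _ = ∫⁻ x, (S.tabooOp u x + S.bell x {true} * ∫⁻ y, u y ∂S.ν) ∂π :=
        lintegral_congr fun x => (S.tabooOp_add_bell_mul u x).symm
    _ = _ := by
        rw [lintegral_add_left (S.measurable_tabooOp hu),
          lintegral_mul_const _ (S.bell.measurable_coe (measurableSet_singleton _)),
          lintegral_congr hb, lintegral_indicator_const S.measurableSet_J]

lemma lintegral_invariant_eq_iterate (hinv : Kernel.Invariant P π) {u : X → ℝ≥0∞}
    (hu : Measurable u) (n : ℕ) :
    ∫⁻ x, u x ∂π = ∫⁻ x, S.tabooOp^[n] u x ∂π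
      + ENNReal.ofReal S.β * π S.J * ∑ i ∈ Finset.range n, ∫⁻ x, S.tabooOp^[i] u x ∂S.ν := by
  induction n with
  | zero => simp
  | succ n ih =>
    rw [ih, S.lintegral_invariant_eq hinv (S.measurable_tabooOp_iterate hu n),
      Finset.sum_range_succ, Function.iterate_succ_apply']
    ring

omit [IsMarkovKernel P] in
lemma lintegral_green_ν {u : X → ℝ≥0∞} (hu : Measurable u) :
    ∫⁻ x, S.green u x ∂S.ν = ∑' i, ∫⁻ x, S.tabooOp^[i] u x ∂S.ν :=
  lintegral_tsum fun n => (S.measurable_tabooOp_iterate hu n).aemeasurable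

/-- One half of Kac's formula: discard the nonnegative remainder ∫ Kⁿu dπ in the iterated identity
and let n → ∞. -/
lemma mul_lintegral_green_le (hinv : Kernel.Invariant P π) {u : X → ℝ≥0∞} (hu : Measurable u) :
    ENNReal.ofReal S.β * π S.J * ∫⁻ x, S.green u x ∂S.ν ≤ ∫⁻ x, u x ∂π := by
  rw [S.lintegral_green_ν hu, ENNReal.tsum_eq_iSup_nat, ENNReal.mul_iSup]
  refine iSup_le fun n => ?_
  rw [S.lintegral_invariant_eq_iterate hinv hu n]
  exact le_add_self

variable [IsProbabilityMeasure π]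

/-- Kⁿ1(x) is the probability of no bell before time n, a term of the convergent series G 1(x);
dominated convergence then applies with bound 1. -/
lemma tendsto_lintegral_tabooOp_iterate_one (hfin : ∀ x, S.green 1 x ≠ ∞) :
    Tendsto (fun n => ∫⁻ x, S.tabooOp^[n] 1 x ∂π) atTop (nhds 0) := by
  have hle : ∀ n x, S.tabooOp^[n] 1 x ≤ 1 := by
    intro n
    induction n with
    | zero => intro x; simp
    | succ n ih =>
      intro x
      rw [Function.iterate_succ_apply']
      refine (S.tabooOp_mono (v := 1) ih x).trans ?_
      simpa [tabooOp] using S.taboo_le x Set.univ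
  have := tendsto_lintegral_of_dominated_convergence (μ := π) (f := fun _ => 0) (fun _ => 1)
    (fun n => S.measurable_tabooOp_iterate measurable_one n) (fun n => ae_of_all _ (hle n))
    (by simp) (ae_of_all _ fun x => ENNReal.tendsto_atTop_zero_of_tsum_ne_top (hfin x))
  simpa using this

/-- The other half of Kac's formula. For u truncated at M the remainder is at most M ∫ Kⁿ1 dπ, which
vanishes in the limit; the truncation is then removed by monotone convergence. -/
lemma lintegral_le_mul_lintegral_green (hinv : Kernel.Invariant P π)
    (hfin : ∀ x, S.green 1 x ≠ ∞) {u : X → ℝ≥0∞} (hu : Measurable u) :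
    ∫⁻ x, u x ∂π ≤ ENNReal.ofReal S.β * π S.J * ∫⁻ x, S.green u x ∂S.ν := by
  have htrunc : ∀ M : ℕ, ∫⁻ x, min (u x) M ∂π
      ≤ ENNReal.ofReal S.β * π S.J * ∫⁻ x, S.green u x ∂S.ν := by
    intro M
    have huM : Measurable fun x => min (u x) (M : ℝ≥0∞) := hu.min measurable_const
    have hiter : ∀ n x, S.tabooOp^[n] (fun x => min (u x) (M : ℝ≥0∞)) x
        ≤ M * S.tabooOp^[n] 1 x := by
      intro n
      induction n with
      | zero => intro x; simp
      | succ n ih =>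
        intro x
        rw [Function.iterate_succ_apply', Function.iterate_succ_apply']
        refine (S.tabooOp_mono ih x).trans (le_of_eq ?_)
        rw [tabooOp, lintegral_const_mul _ (S.measurable_tabooOp_iterate measurable_one n),
          tabooOp]
    have hstep : ∀ n, ∫⁻ x, min (u x) M ∂π ≤ M * ∫⁻ x, S.tabooOp^[n] 1 x ∂π
        + ENNReal.ofReal S.β * π S.J * ∫⁻ x, S.green u x ∂S.ν := by
      intro n
      rw [S.lintegral_invariant_eq_iterate hinv huM n]
      gcongr
      · rw [← lintegral_const_mul _ (S.measurable_tabooOp_iterate measurable_one n)]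
        exact lintegral_mono (hiter n)
      · refine le_trans ?_ (lintegral_mono (S.green_mono fun x => min_le_left (u x) (M : ℝ≥0∞)))
        rw [S.lintegral_green_ν huM]
        exact ENNReal.sum_le_tsum _
    have hlim := (ENNReal.Tendsto.const_mul (a := (M : ℝ≥0∞))
      (S.tendsto_lintegral_tabooOp_iterate_one hfin) (Or.inr (ENNReal.natCast_ne_top M))).add_const
        (ENNReal.ofReal S.β * π S.J * ∫⁻ x, S.green u x ∂S.ν)
    rw [mul_zero, zero_add] at hlim
    exact ge_of_tendsto' hlim hstep
  have hsup : ∀ x, u x = ⨆ M : ℕ, min (u x) (M : ℝ≥0∞) := by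
    intro x
    rw [← inf_iSup_eq, ENNReal.iSup_natCast, inf_top_eq]
  rw [lintegral_congr hsup, lintegral_iSup (fun M => hu.min measurable_const)
    fun M N h x => min_le_min le_rfl (by exact_mod_cast h)]
  exact iSup_le htrunc

lemma mul_meanT_ν (hinv : Kernel.Invariant P π) (hfin : ∀ x, S.green 1 x ≠ ∞) :
    ENNReal.ofReal S.β * π S.J * S.meanT S.ν = 1 := by
  rw [S.meanT_eq]
  refine le_antisymm ((S.mul_lintegral_green_le hinv measurable_one).trans (by simp)) ?_
  refine le_trans (by simp) (S.lintegral_le_mul_lintegral_green hinv hfin measurable_one)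

end Kac

end SmallSet

/-! ### Estimates from the drift of V and of √V -/

lemma sqrt_lt_one_of_lt_one {a : ℝ} (h : a < 1) : √a < 1 :=
  (Real.sqrt_lt' one_pos).2 (by simpa using h)

namespace SmallSet

section Bounds

variable {X : Type*} [MeasurableSpace X] {P : Kernel X X} [IsMarkovKernel P] {π : Measure X}
  (S : SmallSet P π) {V : X → ℝ} {lam K : ℝ}

lemma drift_sqrt (hVm : Measurable V) (hV1 : ∀ x, 1 ≤ V x) (hlam0 : 0 ≤ lam)
    (hdrift : ∀ x, x ∉ S.J → ∫⁻ y, ENNReal.ofReal (V y) ∂(P x) ≤ ENNReal.ofReal (lam * V x))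
    (x : X) (hx : x ∉ S.J) :
    ∫⁻ y, ENNReal.ofReal √(V y) ∂(P x) ≤ ENNReal.ofReal (√lam * √(V x)) := by
  rw [← Real.sqrt_mul hlam0]
  exact lintegral_sqrt_le hVm hV1 (hdrift x hx)

variable (hVm : Measurable V) (hV1 : ∀ x, 1 ≤ V x) (hlam0 : 0 ≤ lam) (hlam1 : lam < 1)
  (hdrift : ∀ x, x ∉ S.J → ∫⁻ y, ENNReal.ofReal (V y) ∂(P x) ≤ ENNReal.ofReal (lam * V x))
  (hdriftJ : ∀ x ∈ S.J, ∫⁻ y, ENNReal.ofReal (V y) ∂(P x) ≤ ENNReal.ofReal K)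

include hVm hV1 hlam0 hlam1 hdrift hdriftJ

lemma tabooOp_green_sqrt_le (x : X) :
    0 ≤ √lam / (1 - √lam) * √(V x) + (√K - √lam - S.β) / (S.β * (1 - √lam)) ∧
    S.tabooOp (S.green fun y => ENNReal.ofReal √(V y)) x
      ≤ ENNReal.ofReal (√lam / (1 - √lam) * √(V x)
          + (√K - √lam - S.β) / (S.β * (1 - √lam))) :=
  S.tabooOp_green_le_of_drift hVm.sqrt (fun x => Real.one_le_sqrt.2 (hV1 x))
    (Real.sqrt_nonneg _) (sqrt_lt_one_of_lt_one hlam1) (S.drift_sqrt hVm hV1 hlam0 hdrift)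
    (fun x hx => lintegral_sqrt_le hVm hV1 (hdriftJ x hx)) x

lemma green_sqrt_le (x : X) :
    S.green (fun y => ENNReal.ofReal √(V y)) x
      ≤ ENNReal.ofReal (1 / (1 - √lam) * √(V x)
          + (√K - √lam - S.β) / (S.β * (1 - √lam))) :=
  (S.green_le_of_drift hVm.sqrt (fun x => Real.one_le_sqrt.2 (hV1 x))
    (Real.sqrt_nonneg _) (sqrt_lt_one_of_lt_one hlam1) (S.drift_sqrt hVm hV1 hlam0 hdrift)
    (fun x hx => lintegral_sqrt_le hVm hV1 (hdriftJ x hx)) x).2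

/-- Writing G 1 = 1 + K G 1 before comparing 1 with V gives the coefficient λ/(1-λ) rather than
1/(1-λ). -/
lemma green_one_le (x : X) :
    0 ≤ lam / (1 - lam) * V x + (K - lam - S.β) / (S.β * (1 - lam)) ∧
    S.green 1 x ≤ 1 + ENNReal.ofReal (lam / (1 - lam) * V x
      + (K - lam - S.β) / (S.β * (1 - lam))) := by
  obtain ⟨h0, h⟩ := S.tabooOp_green_le_of_drift hVm hV1 hlam0 hlam1 hdrift hdriftJ x
  refine ⟨h0, ?_⟩
  rw [S.green_eq_add measurable_one]
  refine add_le_add le_rfl ((S.tabooOp_mono (S.green_mono fun y => ?_) x).trans h)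
  simpa using hV1 y

lemma green_one_ne_top (x : X) : S.green 1 x ≠ ∞ :=
  ((S.green_one_le hVm hV1 hlam0 hlam1 hdrift hdriftJ x).2.trans_lt (by simp)).ne

/-- By Kac's formula π(V) is at most βπ(J) ∫ G V dν, and G V is bounded by an affine function of V,
which is ν-integrable. -/
lemma integrable_of_drift [IsProbabilityMeasure π] (hinv : Kernel.Invariant P π) :
    Integrable V π := by
  refine integrable_of_one_le_of_lintegral_ne_top hVm hV1 (ne_of_lt ?_)
  refine (S.lintegral_le_mul_lintegral_green hinv
    (S.green_one_ne_top hVm hV1 hlam0 hlam1 hdrift hdriftJ) hVm.ennreal_ofReal).trans_lt ?_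
  refine ENNReal.mul_lt_top (ENNReal.mul_lt_top ENNReal.ofReal_lt_top (measure_lt_top _ _)) ?_
  refine (lintegral_mono fun x =>
    (S.green_le_of_drift hVm hV1 hlam0 hlam1 hdrift hdriftJ x).2).trans_lt ?_
  have hi : Integrable (fun x => 1 / (1 - lam) * V x + (K - lam - S.β) / (S.β * (1 - lam))) S.ν :=
    ((S.integrable_ν_of_drift hVm hV1 hdriftJ).const_mul _).add (integrable_const _)
  exact hi.lintegral_lt_top

omit [IsMarkovKernel P] hVm hV1 hlam0 hlam1 hdrift hdriftJ in
/-- The second moment density is monotone and homogeneous of degree two. -/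
lemma secondMoment_le_mul {u w : X → ℝ≥0∞} (hw : Measurable w) {c : ℝ≥0∞}
    (h : ∀ x, u x ≤ c * w x) (x : X) : S.secondMoment u x ≤ c ^ 2 * S.secondMoment w x := by
  have h1 : S.tabooOp (S.green u) x ≤ c * S.tabooOp (S.green w) x := by
    rw [tabooOp, tabooOp, ← lintegral_const_mul _ (S.measurable_green hw)]
    refine lintegral_mono fun y => ?_
    rw [← S.green_const_mul hw]
    exact S.green_mono h y
  calc S.secondMoment u x
      ≤ (c * w x) ^ 2 + 2 * (c * w x) * (c * S.tabooOp (S.green w) x) := by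
        unfold secondMoment
        gcongr
        exacts [h x, h x]
    _ = c ^ 2 * S.secondMoment w x := by unfold secondMoment; ring

lemma secondMoment_le {u : X → ℝ≥0∞} {N : ℝ} (hN : 0 ≤ N)
    (hu : ∀ x, u x ≤ ENNReal.ofReal N * ENNReal.ofReal √(V x)) (x : X) :
    0 ≤ (1 + √lam) / (1 - √lam) * V x
        + 2 * (√K - √lam - S.β) / (S.β * (1 - √lam)) * √(V x) ∧
    S.secondMoment u x ≤ ENNReal.ofReal (N ^ 2) * ENNReal.ofReal
      ((1 + √lam) / (1 - √lam) * V x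
        + 2 * (√K - √lam - S.β) / (S.β * (1 - √lam)) * √(V x)) := by
  obtain ⟨h0, h⟩ := S.tabooOp_green_sqrt_le hVm hV1 hlam0 hlam1 hdrift hdriftJ x
  set b := (√K - √lam - S.β) / (S.β * (1 - √lam)) with hb
  have hs : √lam < 1 := sqrt_lt_one_of_lt_one hlam1
  have hs' : 1 - √lam ≠ 0 := by linarith
  have hV0 : 0 ≤ V x := zero_le_one.trans (hV1 x)
  have hsq : √(V x) ^ 2 = V x := Real.sq_sqrt hV0
  -- Since `b` may be negative, nonnegativity is read off this form, whose bracket is nonnegative by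
  -- `h0`.
  have e : (1 + √lam) / (1 - √lam) * V x
      + 2 * (√K - √lam - S.β) / (S.β * (1 - √lam)) * √(V x)
      = √(V x) ^ 2 + 2 * √(V x) * (√lam / (1 - √lam) * √(V x) + b) := by
    have h1 : (1 + √lam) / (1 - √lam) = 1 + 2 * (√lam / (1 - √lam)) := by field_simp; ring
    have h2 : 2 * (√K - √lam - S.β) / (S.β * (1 - √lam)) = 2 * b := by rw [hb, mul_div_assoc]
    rw [h1, h2]
    linear_combination (-1 - 2 * (√lam / (1 - √lam))) * hsq
  have hr := Real.sqrt_nonneg (V x)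
  rw [e]
  refine ⟨by positivity, (S.secondMoment_le_mul hVm.sqrt.ennreal_ofReal hu x).trans ?_⟩
  rw [← ENNReal.ofReal_pow hN]
  refine mul_le_mul_right ?_ _
  rw [ENNReal.ofReal_add (by positivity) (by positivity), ENNReal.ofReal_mul (by positivity),
    ENNReal.ofReal_mul (by norm_num), ENNReal.ofReal_pow hr, ENNReal.ofReal_ofNat]
  unfold secondMoment
  gcongr

lemma green_secondMoment_le {u : X → ℝ≥0∞} {N : ℝ} (hN : 0 ≤ N)
    (hu : ∀ x, u x ≤ ENNReal.ofReal N * ENNReal.ofReal √(V x)) (x : X) :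
    0 ≤ 1 / (1 - √lam) ^ 2 * V x
        + 2 * max (√K - √lam - S.β) 0 / (S.β * (1 - √lam) ^ 2) * √(V x)
        + (S.β * (K - lam - S.β) + 2 * max (√K - √lam - S.β) 0 ^ 2)
          / (S.β ^ 2 * (1 - √lam) ^ 2) ∧
    S.green (S.secondMoment u) x ≤ ENNReal.ofReal (N ^ 2) * ENNReal.ofReal
      (1 / (1 - √lam) ^ 2 * V x
        + 2 * max (√K - √lam - S.β) 0 / (S.β * (1 - √lam) ^ 2) * √(V x)
        + (S.β * (K - lam - S.β) + 2 * max (√K - √lam - S.β) 0 ^ 2)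
          / (S.β ^ 2 * (1 - √lam) ^ 2)) := by
  have hβ := S.β_pos
  have hs : √lam < 1 := sqrt_lt_one_of_lt_one hlam1
  have hs0 : 0 < 1 - √lam := by linarith
  have hs1 : 0 < 1 + √lam := by linarith [Real.sqrt_nonneg lam]
  have hl0 : 1 - lam = (1 - √lam) * (1 + √lam) := by
    linear_combination Real.sq_sqrt hlam0
  -- The coefficient of √V must be nonnegative for the upper bound on G √V to be inserted, hence the
  -- positive part.
  set m := max (√K - √lam - S.β) 0 with hm
  have hm0 : 0 ≤ m := le_max_right _ _
  have hml : √K - √lam - S.β ≤ m := le_max_left _ _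
  set p := (1 + √lam) / (1 - √lam) with hp
  set q := 2 * m / (S.β * (1 - √lam)) with hq
  have hp0 : 0 ≤ p := by positivity
  have hq0 : 0 ≤ q := by positivity
  have hVx : ∀ y, 0 ≤ V y := fun y => zero_le_one.trans (hV1 y)
  obtain ⟨hg0, hg⟩ := S.green_le_of_drift hVm hV1 hlam0 hlam1 hdrift hdriftJ x
  have hgs : S.green (fun y => ENNReal.ofReal √(V y)) x
      ≤ ENNReal.ofReal (1 / (1 - √lam) * √(V x) + m / (S.β * (1 - √lam))) := by
    refine (S.green_sqrt_le hVm hV1 hlam0 hlam1 hdrift hdriftJ x).trans ?_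
    gcongr
  have hgs0 : 0 ≤ 1 / (1 - √lam) * √(V x) + m / (S.β * (1 - √lam)) := by positivity
  have hpt : ∀ y, S.secondMoment u y ≤ ENNReal.ofReal (N ^ 2) *
      (ENNReal.ofReal p * ENNReal.ofReal (V y) + ENNReal.ofReal q * ENNReal.ofReal √(V y)) := by
    intro y
    refine (S.secondMoment_le hVm hV1 hlam0 hlam1 hdrift hdriftJ hN hu y).2.trans ?_
    rw [← ENNReal.ofReal_mul hp0, ← ENNReal.ofReal_mul hq0,
      ← ENNReal.ofReal_add (mul_nonneg hp0 (hVx y)) (by positivity)]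
    have hbq : 2 * (√K - √lam - S.β) / (S.β * (1 - √lam)) ≤ q := by
      rw [hq]; gcongr
    gcongr
  have e : 1 / (1 - √lam) ^ 2 * V x + 2 * m / (S.β * (1 - √lam) ^ 2) * √(V x)
        + (S.β * (K - lam - S.β) + 2 * m ^ 2) / (S.β ^ 2 * (1 - √lam) ^ 2)
      = p * (1 / (1 - lam) * V x + (K - lam - S.β) / (S.β * (1 - lam)))
        + q * (1 / (1 - √lam) * √(V x) + m / (S.β * (1 - √lam))) := by
    rw [hp, hq]
    -- The factor 1 + √λ of 1 - λ cancels the numerator of `p`, which leaves (1-√λ)² in the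
    -- denominators.
    have h1 : (1 - lam)⁻¹ = (1 - √lam)⁻¹ * (1 + √lam)⁻¹ := by rw [hl0, mul_inv]
    simp only [div_eq_mul_inv, mul_inv, h1, ← inv_pow]
    have h2 : (1 + √lam) * (1 + √lam)⁻¹ = 1 := mul_inv_cancel₀ hs1.ne'
    have h3 : S.β * S.β⁻¹ = 1 := mul_inv_cancel₀ hβ.ne'
    generalize (1 + √lam)⁻¹ = t at *
    generalize (1 - √lam)⁻¹ = r at *
    linear_combination (-(r ^ 2 * V x + r ^ 2 * (K - lam - S.β) * S.β⁻¹)) * h2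
      + (K - lam - S.β) * S.β⁻¹ * r ^ 2 * h3
  rw [e]
  refine ⟨by positivity, ?_⟩
  have hVe := hVm.ennreal_ofReal
  have hse := hVm.sqrt.ennreal_ofReal
  refine (S.green_mono hpt x).trans ?_
  rw [S.green_const_mul (by fun_prop), S.green_add (by fun_prop), S.green_const_mul hVe,
    S.green_const_mul hse, ENNReal.ofReal_add (mul_nonneg hp0 hg0) (mul_nonneg hq0 hgs0),
    ENNReal.ofReal_mul hp0, ENNReal.ofReal_mul hq0]
  gcongr

lemma lintegral_blockTotal_sq_le_initialBound {u : X → ℝ≥0∞} (hum : Measurable u) {N : ℝ}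
    (hN : 0 ≤ N) (hu : ∀ x, u x ≤ ENNReal.ofReal N * ENNReal.ofReal √(V x))
    (η : Measure X) [IsProbabilityMeasure η] (hη : Integrable V η) :
    0 ≤ initialBound lam K S.β V η ∧
    ∫⁻ ω, blockTotal u ω ^ 2 ∂(S.law η)
      ≤ ENNReal.ofReal (N ^ 2 * initialBound lam K S.β V η) := by
  have hb := S.green_secondMoment_le hVm hV1 hlam0 hlam1 hdrift hdriftJ hN hu
  obtain ⟨h0, h⟩ := lintegral_ofReal_combination hη (integrable_sqrt hVm hV1 hη)
    fun x => (hb x).1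
  refine ⟨h0, (S.lintegral_blockTotal_sq_le η hum).trans ?_⟩
  refine (lintegral_mono fun x => (hb x).2).trans ?_
  rw [lintegral_const_mul' _ _ ENNReal.ofReal_ne_top, h,
    ENNReal.ofReal_mul (sq_nonneg N), initialBound]

end Bounds

end SmallSet

lemma abs_le_weightedNorm_mul {X : Type*} {V g : X → ℝ} (hV1 : ∀ x, 1 ≤ V x)
    (hnorm : BddAbove (Set.range (weightedAbs V g))) (x : X) :
    |g x| ≤ weightedNorm V g * √(V x) :=
  (div_le_iff₀ (Real.sqrt_pos.2 (zero_lt_one.trans_le (hV1 x)))).1 (le_ciSup hnorm x)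

lemma weightedNorm_nonneg {X : Type*} (V g : X → ℝ) : 0 ≤ weightedNorm V g :=
  Real.iSup_nonneg fun _ => div_nonneg (abs_nonneg _) (Real.sqrt_nonneg _)

end

/-! ### Assembly of the four bounds -/

theorem theorem4p2 {X : Type*} [TopologicalSpace X] [PolishSpace X] [MeasurableSpace X]
    [BorelSpace X] (P : Kernel X X) [IsMarkovKernel P] (π : Measure X) [IsProbabilityMeasure π]
    (hinv : Kernel.Invariant P π) (hirr : Kernel.IsIrreducible π P) (hHarris : HarrisRecurrent P π)
    (S : SmallSet P π)
    (V : X → ℝ) (hVm : Measurable V) (hV1 : ∀ x, 1 ≤ V x)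
    (lam K : ℝ) (hlam0 : 0 ≤ lam) (hlam1 : lam < 1)
    (hdrift : ∀ x, x ∉ S.J → ∫⁻ y, ENNReal.ofReal (V y) ∂(P x) ≤ ENNReal.ofReal (lam * V x))
    (hdriftJ : ∀ x ∈ S.J, ∫⁻ y, ENNReal.ofReal (V y) ∂(P x) ≤ ENNReal.ofReal K)
    (f : X → ℝ) (hf : Measurable f)
    (hnorm : BddAbove (Set.range (weightedAbs V (S.centred f)))) :
    -- the quantities `π(V)`, `π(V^{1/2})`, `π(f)` and `E_ν T` are finite
    (Integrable V π ∧ Integrable (fun x => √(V x)) π ∧ Integrable f π ∧ S.meanT S.ν ≠ ∞) ∧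
    -- (i)
    S.C₀ ≤ ((lam / (1 - lam) * ∫ x, V x ∂π
        + (K - lam - S.β) / (S.β * (1 - lam)) + 1 / 2 : ℝ) : EReal) ∧
    -- (ii)
    (S.asVar f : EReal) ≤ ((weightedNorm V (S.centred f) ^ 2 *
        ((1 + √lam) / (1 - √lam) * ∫ x, V x ∂π
          + 2 * (√K - √lam - S.β) / (S.β * (1 - √lam)) * ∫ x, √(V x) ∂π) : ℝ) : EReal) ∧
    -- (iii); if `ξ(V) = ∞` the right-hand side is infinite and there is nothing to prove
    (∀ ξ : Measure X, IsProbabilityMeasure ξ → Integrable V ξ →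
      ((S.C₁ f ξ ^ 2 : ℝ≥0∞) : EReal) ≤
        ((weightedNorm V (S.centred f) ^ 2 * initialBound lam K S.β V ξ : ℝ) : EReal)) ∧
    -- (iv)
    (∀ ξ : Measure X, IsProbabilityMeasure ξ → ∀ n : ℕ, Integrable V (ξ.bind (P ^ n : Kernel X X)) →
      ((S.C₂ f ξ n ^ 2 : ℝ≥0∞) : EReal) ≤
        ((weightedNorm V (S.centred f) ^ 2
          * initialBound lam K S.β V (ξ.bind (P ^ n : Kernel X X)) : ℝ) : EReal)) := by
  have hVπ := S.integrable_of_drift hVm hV1 hlam0 hlam1 hdrift hdriftJ hinv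
  have hsπ := integrable_sqrt hVm hV1 hVπ
  have hfin := S.green_one_ne_top hVm hV1 hlam0 hlam1 hdrift hdriftJ
  have hkac := S.mul_meanT_ν hinv hfin
  have hgm : Measurable (S.centred f) := hf.sub_const _
  set N := weightedNorm V (S.centred f)
  have hN : 0 ≤ N := weightedNorm_nonneg _ _
  have habs : ∀ x, |S.centred f x| ≤ N * √(V x) := abs_le_weightedNorm_mul hV1 hnorm
  set u : X → ℝ≥0∞ := fun x => ENNReal.ofReal |S.centred f x|
  have hum : Measurable u := (continuous_abs.measurable.comp hgm).ennreal_ofReal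
  have hu : ∀ x, u x ≤ ENNReal.ofReal N * ENNReal.ofReal √(V x) := by
    intro x
    rw [← ENNReal.ofReal_mul hN]
    exact ENNReal.ofReal_le_ofReal (habs x)
  have hsq : ∀ a : ℝ≥0∞, (a ^ (1 / 2 : ℝ)) ^ 2 = a := by
    intro a
    rw [← ENNReal.rpow_natCast, ← ENNReal.rpow_mul]
    norm_num
  refine ⟨⟨hVπ, hsπ, ?_, ?_⟩, ?_, ?_, ?_, ?_⟩
  · have h1 : Integrable (S.centred f) π :=
      (hsπ.const_mul N).mono' hgm.aestronglyMeasurable (ae_of_all _ habs)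
    have h2 := h1.add (integrable_const (∫ y, f y ∂π))
    refine h2.congr (ae_of_all _ fun x => ?_)
    simp [SmallSet.centred]
  · intro h
    rw [h, ENNReal.mul_top] at hkac
    · exact ENNReal.top_ne_one hkac
    · exact mul_ne_zero (by simpa using S.β_pos) S.measure_J_pos.ne'
  · have hb := S.green_one_le hVm hV1 hlam0 hlam1 hdrift hdriftJ
    obtain ⟨h0, h⟩ := lintegral_ofReal_combination hVπ hsπ (p := lam / (1 - lam)) (q := 0)
      (r := (K - lam - S.β) / (S.β * (1 - lam))) fun x => by simpa using (hb x).1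
    simp only [zero_mul, add_zero] at h0 h
    have hT : S.meanT π ≤ ENNReal.ofReal (1 + (lam / (1 - lam) * ∫ x, V x ∂π
        + (K - lam - S.β) / (S.β * (1 - lam)))) := by
      rw [S.meanT_eq, ENNReal.ofReal_add zero_le_one h0, ← h, ENNReal.ofReal_one]
      refine (lintegral_mono fun x => (hb x).2).trans (le_of_eq ?_)
      rw [lintegral_add_left measurable_const]
      simp
    refine EReal.sub_le_of_le_add ((coe_le_coe_of_le_ofReal (by linarith) hT).trans (le_of_eq ?_))
    rw [← EReal.coe_add]
    congr 1
    ring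
  · have hb := S.secondMoment_le hVm hV1 hlam0 hlam1 hdrift hdriftJ hN hu
    obtain ⟨h0, h⟩ := lintegral_ofReal_combination hVπ hsπ (r := 0)
      fun x => by rw [add_zero]; exact (hb x).1
    simp only [add_zero] at h0 h
    refine coe_le_coe_of_le_ofReal (mul_nonneg (sq_nonneg N) h0) ?_
    -- Dividing by E_ν T is multiplying by βπ(J), so Kac's formula turns the integral of the Green
    -- potential against ν into an integral of `secondMoment u` against π; no second Green estimate
    -- is needed.
    have hinv' : (S.meanT S.ν)⁻¹ = ENNReal.ofReal S.β * π S.J :=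
      (ENNReal.eq_inv_of_mul_eq_one_left hkac).symm
    calc S.asVar f
        ≤ (∫⁻ x, S.green (S.secondMoment u) x ∂S.ν) / S.meanT S.ν := by
          refine ENNReal.div_le_div_right ?_ _
          exact (lintegral_mono fun ω => ofReal_blockSum_sq_le _ ω).trans
            (S.lintegral_blockTotal_sq_le S.ν hum)
      _ = ENNReal.ofReal S.β * π S.J * ∫⁻ x, S.green (S.secondMoment u) x ∂S.ν := by
          rw [ENNReal.div_eq_inv_mul, hinv']
      _ ≤ ∫⁻ x, S.secondMoment u x ∂π :=
          S.mul_lintegral_green_le hinv (S.measurable_secondMoment hum)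
      _ ≤ _ := (lintegral_mono fun x => (hb x).2).trans (by
          rw [lintegral_const_mul' _ _ ENNReal.ofReal_ne_top, h, ENNReal.ofReal_mul (sq_nonneg N)])
  · intro ξ hξ hVξ
    obtain ⟨h0, h⟩ := S.lintegral_blockTotal_sq_le_initialBound hVm hV1 hlam0 hlam1 hdrift hdriftJ
      hum hN hu ξ hVξ
    refine coe_le_coe_of_le_ofReal (mul_nonneg (sq_nonneg N) h0) ?_
    rw [SmallSet.C₁, hsq, lintegral_congr fun ω => by rw [absSum_zero_eq_blockTotal]]
    exact h
  · intro ξ hξ n hVξ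
    have := isMarkovKernel_pow P n
    obtain ⟨h0, h⟩ := S.lintegral_blockTotal_sq_le_initialBound hVm hV1 hlam0 hlam1 hdrift hdriftJ
      hum hN hu _ hVξ
    refine coe_le_coe_of_le_ofReal (mul_nonneg (sq_nonneg N) h0) ?_
    rw [SmallSet.C₂, hsq]
    refine le_trans (lintegral_mono fun ω => ?_) ((S.lintegral_law_shift ξ
      ((measurable_blockTotal hum).pow_const 2) n).trans_le h)
    -- The restriction to T_1 < n is dropped, since the shifted block sum dominates on every path.
    refine pow_le_pow_left' ((Set.indicator_le_self _ _ ω).trans ?_) 2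
    exact absSum_regenIndex_le _ ω n
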